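/- Consider $N\ge 1$ queues. Let $\mathcal C\subset[0,\infty)^N$ be compact and coordinate-convex (if $\bar\mu\in\mathcal C$ and $0\le\bar\mu^*\le\bar\mu$ coordinate-wise, then $\bar\mu^*\in\mathcal C$). Let $h:[0,\infty)\to[-\infty,\infty)$ be real-valued, strictly increasing, differentiable and concave on $(0,\infty)$, with $h(0)=\lim_{y\downarrow 0}h(y)\ge-\infty$. Let $g:\mathbb Z_+\to[0,\infty)$ be strictly increasing with $g(y)/(g(y+1)-g(y))\to\infty$ and $g(y)\to\infty$ as $y\to\infty$. For every state $\bar x\in\mathbb Z_+^N$ let $\bar\psi(\bar x)=(\psi_i(\bar x))_{i\le N}$ satisfy $\psi_i(\bar x)=0$ whenever $x_i=0$, and $$\bar\psi(\bar x)\in\operatorname*{arg\,max}_{\bar\mu\in\mathcal C}\ \sum_{i:\,x_i>0} g(x_i)h(\mu_i).$$ Let $\lambda_i>0$ for $i=1,\dots,N$, and let $\bar X(t)$, $t\ge 0$, be the continuous-time Markov process of queue lengths on $\mathbb Z_+^N$, with right-continuous paths, given by $$X_i(t)=X_i(0)+A_i(\lambda_i t)-\Pi_i\Bigl(\int_0^t\psi_i(\bar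 X(\tau))\,d\tau\Bigr),\qquad t\ge 0,\ i=1,\dots,N,$$ where $A_1,\dots,A_N,\Pi_1,\dots,\Pi_N$ are independent unit-rate Poisson processes (so arrivals into queue $i$ are Poisson of rate $\lambda_i$, and departures from it have instantaneous rate $\psi_i(\bar X(t))$). Theorem. If there exists $\bar\nu\in\mathcal C$ with $\lambda_i<\nu_i$ for all $i$, then the process $\bar X$ is positive recurrent: for every deterministic initial state $\bar X(0)=\bar x$ and every state $\bar y$ (in particular $\bar y=\bar x$), the first time at which $\bar X$ is in $\bar y$ after having left its initial state has finite expectation. -/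

import Mathlib

open MeasureTheory ProbabilityTheory Filter Topology
open scoped ENNReal

noncomputable section

namespace QueueNetwork

/-- Condition (H) on `h : [0, ∞) → [-∞, ∞)` (values at negative arguments are irrelevant):
real-valued on `(0, ∞)`, strictly increasing, differentiable and concave there, with
`h 0 = lim_{y ↓ 0} h y`, which may be finite or `-∞`. -/
structure ConditionH (h : ℝ → EReal) : Prop where
  real_valued : ∀ y : ℝ, 0 < y → h y ≠ ⊥ ∧ h y ≠ ⊤
  strictMono : StrictMonoOn h (Set.Ici 0)
  differentiable : DifferentiableOn ℝ (fun y => (h y).toReal) (Set.Ioi 0)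
  concave : ConcaveOn ℝ (Set.Ioi 0) (fun y => (h y).toReal)
  value_zero : Tendsto h (𝓝[>] 0) (𝓝 (h 0))

/-- Condition (G) on `g : ℤ₊ → [0, ∞)`: strictly increasing, with `g(y) / (g(y+1) - g(y)) → ∞`,
and unbounded. -/
structure ConditionG (g : ℕ → ℝ) : Prop where
  nonneg : ∀ y, 0 ≤ g y
  strictMono : StrictMono g
  ratio : Tendsto (fun y => g y / (g (y + 1) - g y)) atTop atTop
  unbounded : Tendsto g atTop atTop

/-- A compact, coordinate-convex set of nonnegative rate vectors. -/
structure IsRateRegion {ι : Type*} (C : Set (ι → ℝ)) : Prop where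
  nonneg : ∀ μ ∈ C, ∀ i, 0 ≤ μ i
  compact : IsCompact C
  coordConvex : ∀ μ ∈ C, ∀ μ' : ι → ℝ, (∀ i, 0 ≤ μ' i) → (∀ i, μ' i ≤ μ i) → μ' ∈ C

/-- The utility `∑_i g(x_i) h(μ_i)` of the rates `μ` in state `x`; empty queues do not contribute.
No summand is `+∞`, so the sum in `[-∞, ∞)` is the usual one. -/
def utility {ι : Type*} [Fintype ι] (g : ℕ → ℝ) (h : ℝ → EReal) (x : ι → ℕ) (μ : ι → ℝ) : EReal :=
  ∑ i with 0 < x i, (g (x i) : EReal) * h (μ i)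

/-- In every state `x` the rate vector `ψ x` is a maximiser of the utility over `C`, and empty
queues get rate zero. -/
structure IsUtilityMaximising {ι : Type*} [Fintype ι] (C : Set (ι → ℝ)) (g : ℕ → ℝ)
    (h : ℝ → EReal) (ψ : (ι → ℕ) → ι → ℝ) : Prop where
  mem : ∀ x, ψ x ∈ C
  isMax : ∀ x, ∀ μ ∈ C, utility g h x μ ≤ utility g h x (ψ x)
  empty : ∀ x i, x i = 0 → ψ x i = 0

/-- The number of events up to and including time `t` when successive events are separated by
`gap 0, gap 1, …`. -/
def renewalCount (gap : ℕ → ℝ) (t : ℝ) : ℕ :=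
  Set.ncard {n : ℕ | ∑ k ∈ Finset.range (n + 1), gap k ≤ t}

/-- `N c`, `c : κ`, are independent Poisson processes of unit rate on `[0, ∞)`: counting processes
whose inter-event times are independent exponential variables of parameter one. -/
def IsIndepUnitPoisson {κ Ω : Type*} [MeasurableSpace Ω] (P : Measure Ω)
    (N : κ → ℝ → Ω → ℕ) : Prop :=
  ∃ gap : κ → ℕ → Ω → ℝ,
    (∀ c n, HasLaw (gap c n) (expMeasure 1) P) ∧
    iIndepFun (fun p : κ × ℕ => gap p.1 p.2) P ∧
    ∀ c, ∀ᵐ ω ∂P, ∀ t, 0 ≤ t → N c t ω = renewalCount (fun n => gap c n ω) t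

/-- `X t`, `t ≥ 0`, is the vector of queue lengths of the network with initial state `x`: the
number of arrivals into queue `i` up to time `t` is `A_i(lam_i t)` and the number of departures is
`Π_i(∫_0^t ψ_i(X(τ)) dτ)`, with `A_i`, `Π_i` independent Poisson processes of unit rate. -/
structure IsNetworkProcess {ι Ω : Type*} [MeasurableSpace Ω] (lam : ι → ℝ)
    (ψ : (ι → ℕ) → ι → ℝ) (x : ι → ℕ) (P : Measure Ω) (X : ℝ → Ω → ι → ℕ) : Prop where
  measurable : ∀ t, 0 ≤ t → Measurable (X t)
  rightCont : ∀ᵐ ω ∂P, ∀ t, 0 ≤ t → ∀ᶠ s in 𝓝[≥] t, X s ω = X t ω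
  dynamics : ∃ N : ι ⊕ ι → ℝ → Ω → ℕ, IsIndepUnitPoisson P N ∧
    ∀ᵐ ω ∂P, ∀ t, 0 ≤ t → ∀ i,
      X t ω i + N (Sum.inr i) (∫ τ in (0 : ℝ)..t, ψ (X τ ω) i) ω
        = x i + N (Sum.inl i) (lam i * t) ω

/-- The first time at which the path is in `y` after having left its initial state
(`∞` if there is none). For a path not starting in `y` this is the first hitting time of `y`. -/
def returnTime {S : Type*} (path : ℝ → S) (y : S) : ℝ≥0∞ :=
  ⨅ (t : ℝ) (_ : 0 ≤ t ∧ path t = y ∧ ∃ s ∈ Set.Icc 0 t, path s ≠ path 0), ENNReal.ofReal t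

end QueueNetwork

end

/-!
The process is analysed through its jump chain, driven by explicit clocks. Each queue has an arrival
clock and a departure clock; in state `z` these run at the speeds `lam i` and `ψ z i`, and each ring
moves the state. The remaining gaps of all clocks are independent unit exponential variables, and by
memorylessness they are so again after the first ring: the clock `c` rings first with probability
proportional to its speed and, given this event, the residual gaps have their original law
(`map_residual_restrict_raceWin`). This is the only form of the Markov property that is needed.

Pathwise, a solution of the balance equations jumps when the first clock rings and then solves the
equations with the residual gaps (`IsPath.firstJump`). So the return time to `y` is at most
the cost of the jump chain up to its first visit to `y` after the first jump, where a jump costs one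
plus an upper bound on its holding time (`ae_forall_isPath_returnTime_le`); the additional one makes
the cost infinite if the chain never visits `y`. By the race, the expected costs satisfy the
one-step recursion of the jump chain, so that any nonnegative function whose drift is at most
`-D` per jump off `y` bounds the expected cost (`lintegral_hitCost_le`).

Such a function is built from the potential `∑ i, w i * (g 1 + ⋯ + g (z i))`, where `w i` is the
derivative of `h` at `ν i` and `ν` is a rate vector that exceeds the arrival rates. As `ψ z` maximises
the utility and `h` lies below its tangents at the `ν i`, the weighted rates satisfy
`∑ i, w i * g (z i) * (ν i - ψ z i) ≤ 0` (`IsUtilityMaximising.sum_weighted_le`); convexity of the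
rate region is not used. The drift of the potential is thus at most that for the fixed service rates
`ν`, and since `g (n + 1) - g n` is negligible against `g n`, it tends to `-∞`. Finally, every state
can reach `y`, and subtracting a large multiple of the expectation of `2 ^ (-τ)`, with `τ` the
number of jumps until `y` is hit, makes the drift negative on the remaining finite set as well
(`exists_lyapunov_off_singleton`).
-/

namespace QueueNetwork

/-! ### Exponential clocks and the race between them -/

instance : IsProbabilityMeasure (expMeasure 1) := isProbabilityMeasure_expMeasure one_pos

lemma expMeasure_apply {r : ℝ} (s : Set ℝ) (hs : MeasurableSet s) :
    expMeasure r s = ∫⁻ x, s.indicator (exponentialPDF r) x := by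
  rw [lintegral_indicator hs, expMeasure, gammaMeasure, withDensity_apply _ hs]
  rfl

lemma measurable_exponentialPDF (r : ℝ) : Measurable (exponentialPDF r) :=
  (measurable_exponentialPDFReal r).ennreal_ofReal

lemma lintegral_expMeasure (r : ℝ) {f : ℝ → ℝ≥0∞} (hf : Measurable f) :
    ∫⁻ s, f s ∂expMeasure r = ∫⁻ s, exponentialPDF r s * f s :=
  lintegral_withDensity_eq_lintegral_mul _ (measurable_exponentialPDF r) hf

/-- Memorylessness of the exponential distribution: given that it exceeds `a`, the excess over `a`
is again exponential. -/
lemma expMeasure_Ioi_inter_preimage_sub {a : ℝ} (ha : 0 ≤ a) {t : Set ℝ} (ht : MeasurableSet t) :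
    expMeasure 1 (Set.Ioi a ∩ (fun x => x - a) ⁻¹' t)
      = ENNReal.ofReal (Real.exp (-a)) * expMeasure 1 t := by
  have hm : MeasurableSet (Set.Ioi a ∩ (fun x => x - a) ⁻¹' t) :=
    measurableSet_Ioi.inter ((measurable_id.sub_const a) ht)
  rw [expMeasure_apply _ hm, expMeasure_apply _ ht, ← lintegral_const_mul _
    ((measurable_exponentialPDF 1).indicator ht), ← lintegral_add_right_eq_self _ a]
  refine lintegral_congr_ae ?_
  filter_upwards [compl_mem_ae_iff.2 (measure_singleton (0 : ℝ))] with y hy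
  have hy : y ≠ 0 := hy
  rcases lt_or_gt_of_ne hy with h | h
  · simp [Set.indicator, exponentialPDF_of_neg h, h.le]
  · by_cases hyt : y ∈ t
    · simp only [Set.indicator, Set.mem_inter_iff, Set.mem_Ioi, Set.mem_preimage, add_sub_cancel_right,
        hyt, and_true, if_true]
      rw [if_pos (by linarith), exponentialPDF_of_nonneg h.le,
        exponentialPDF_of_nonneg (by linarith), ← ENNReal.ofReal_mul (by positivity)]
      congr 1
      rw [one_mul, one_mul, one_mul, ← Real.exp_add]
      ring_nf
    · simp [Set.indicator, hyt]

lemma ae_expMeasure_pos : ∀ᵐ x ∂expMeasure 1, 0 < x := by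
  rw [ae_iff]
  have : {x : ℝ | ¬ 0 < x} = Set.Iic 0 := by ext; simp
  rw [this, expMeasure_apply _ measurableSet_Iic, lintegral_eq_zero_iff
    ((measurable_exponentialPDF 1).indicator measurableSet_Iic)]
  filter_upwards [compl_mem_ae_iff.2 (measure_singleton (0 : ℝ))] with y hy
  rcases lt_or_gt_of_ne (show y ≠ 0 from hy) with h | h
  · simp [Set.indicator, exponentialPDF_of_neg h]
  · simp [Set.indicator, h]

/-- The Laplace transform of the unit exponential distribution. -/
lemma lintegral_exp_neg_mul_expMeasure {r : ℝ} (hr : 0 ≤ r) :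
    ∫⁻ s, ENNReal.ofReal (Real.exp (-(r * s))) ∂expMeasure 1 = ENNReal.ofReal (1 / (1 + r)) := by
  have h1 : 0 < 1 + r := by linarith
  rw [lintegral_expMeasure 1 (by fun_prop)]
  have : ∀ s, exponentialPDF 1 s * ENNReal.ofReal (Real.exp (-(r * s)))
      = ENNReal.ofReal (1 / (1 + r)) * exponentialPDF (1 + r) s := by
    intro s
    rcases lt_or_ge s 0 with hs | hs
    · simp [exponentialPDF_of_neg hs]
    · rw [exponentialPDF_of_nonneg hs, exponentialPDF_of_nonneg hs,
        ← ENNReal.ofReal_mul (by positivity), ← ENNReal.ofReal_mul (by positivity), one_mul,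
        ← Real.exp_add, ← mul_assoc, one_div, inv_mul_cancel₀ h1.ne', one_mul]
      ring_nf
  simp_rw [this]
  rw [lintegral_const_mul _ (measurable_exponentialPDF _), lintegral_exponentialPDF_eq_one h1,
    mul_one]

lemma lintegral_ofReal_expMeasure_lt_top : ∫⁻ s, ENNReal.ofReal s ∂expMeasure 1 < ⊤ := by
  -- `s ≤ 2 exp (s / 2)`, and the exponential moment of order `1 / 2` is finite.
  have key : ∀ s, exponentialPDF 1 s * ENNReal.ofReal s ≤ 4 * exponentialPDF (1 / 2) s := by
    intro s
    rcases lt_or_ge s 0 with hs | hs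
    · simp [exponentialPDF_of_neg hs]
    · rw [exponentialPDF_of_nonneg hs, exponentialPDF_of_nonneg hs,
        ← ENNReal.ofReal_mul (by positivity), show (4 : ℝ≥0∞) = ENNReal.ofReal 4 by simp,
        ← ENNReal.ofReal_mul (by positivity)]
      apply ENNReal.ofReal_le_ofReal
      have h1 : s ≤ 2 * Real.exp (1 / 2 * s) := by
        have := Real.add_one_le_exp (1 / 2 * s)
        linarith
      have h2 : Real.exp (-(1 * s)) * Real.exp (1 / 2 * s) = Real.exp (-(1 / 2 * s)) := by
        rw [← Real.exp_add]; ring_nf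
      calc 1 * Real.exp (-(1 * s)) * s
          ≤ 1 * Real.exp (-(1 * s)) * (2 * Real.exp (1 / 2 * s)) := by gcongr
        _ = 4 * (1 / 2 * Real.exp (-(1 / 2 * s))) := by rw [← h2]; ring
  rw [lintegral_expMeasure 1 (by fun_prop)]
  refine (lintegral_mono key).trans_lt ?_
  rw [lintegral_const_mul _ (measurable_exponentialPDF _),
    lintegral_exponentialPDF_eq_one (by norm_num)]
  simp

/-- The law of the gaps of independent unit-rate Poisson clocks `c : κ`: the gap with index
`(c, n)` separates the `n`-th from the next ring of the clock `c`. -/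
noncomputable def clockLaw (κ : Type*) : Measure (κ × ℕ → ℝ) :=
  Measure.infinitePi fun _ => expMeasure 1

instance (κ : Type*) : IsProbabilityMeasure (clockLaw κ) := by
  unfold clockLaw; infer_instance

/-- Adjoining one more independent coordinate to a product measure. -/
lemma map_option_elim_infinitePi {K E : Type*} [MeasurableSpace E] (ν : Measure E)
    [IsProbabilityMeasure ν] :
    (ν.prod (Measure.infinitePi fun _ : K => ν)).map
      (fun q (o : Option K) => o.elim q.1 q.2) = Measure.infinitePi fun _ => ν := by
  classical
  have hmeas : Measurable fun (q : E × (K → E)) (o : Option K) => o.elim q.1 q.2 := by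
    refine measurable_pi_iff.2 fun o => ?_
    cases o
    · exact measurable_fst
    · exact (measurable_pi_apply _).comp measurable_snd
  refine Measure.eq_infinitePi _ fun S t ht => ?_
  rw [Measure.map_apply hmeas (.pi S.countable_toSet fun _ _ => ht _)]
  -- extending the box by trivial factors makes `none` and its complement appear separately
  set t' : Option K → Set E := fun o => if o ∈ S then t o else Set.univ with ht'
  have ht'm : ∀ o, MeasurableSet (t' o) := by
    intro o; simp only [ht']; split_ifs <;> simp [ht]
  have hpre : (fun (q : E × (K → E)) (o : Option K) => o.elim q.1 q.2) ⁻¹' (Set.pi S t)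
      = t' none ×ˢ Set.pi (Finset.eraseNone S : Finset K) (fun k => t' (some k)) := by
    ext q
    simp only [Set.mem_preimage, Set.mem_pi, Finset.mem_coe, Set.mem_prod, Finset.mem_eraseNone, ht']
    constructor
    · intro H
      refine ⟨?_, fun k hk => by simpa [hk] using H _ hk⟩
      split_ifs with h0
      · exact H none h0
      · trivial
    · rintro ⟨h0, h1⟩ (_ | k) ho
      · simpa [ho] using h0
      · simpa [ho] using h1 k ho
  rw [hpre, Measure.prod_prod, Measure.infinitePi_pi _ (fun k _ => ht'm _)]
  rw [← Finset.prod_insertNone (fun o => ν (t' o)), Finset.insertNone_eraseNone]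
  have hsub : S ⊆ insert none S := Finset.subset_insert _ _
  rw [← Finset.prod_subset hsub (f := fun o => ν (t' o)) (fun o _ ho => by simp [ht', ho])]
  exact Finset.prod_congr rfl fun o ho => by simp [ht', ho]

section Race

variable {κ : Type*}

/-- The event that the clock `c` is the first to ring when the clock `c'` runs at speed `b c'`. -/
def raceWin (b : κ → ℝ) (c : κ) : Set (κ × ℕ → ℝ) :=
  {e | 0 < b c ∧ ∀ c', c' ≠ c → b c' / b c * e (c, 0) < e (c', 0)}

lemma measurableSet_raceWin [Countable κ] (b : κ → ℝ) (c : κ) : MeasurableSet (raceWin b c) := by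
  simp only [raceWin, Set.ofPred_and, Set.ofPred_forall]
  refine (MeasurableSet.const _).inter (.iInter fun c' => .iInter fun _ => ?_)
  exact measurableSet_lt (by fun_prop) (by fun_prop)

lemma disjoint_raceWin {b : κ → ℝ} {c c' : κ} (hne : c ≠ c') :
    Disjoint (raceWin b c) (raceWin b c') := by
  rw [Set.disjoint_left]
  rintro e ⟨hc, h⟩ ⟨hc', h'⟩
  have h1 := h c' hne.symm
  have h2 := h' c hne
  rw [div_mul_eq_mul_div, div_lt_iff₀ hc] at h1
  rw [div_mul_eq_mul_div, div_lt_iff₀ hc'] at h2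
  nlinarith

variable [DecidableEq κ]

/-- The gaps of which the first gap of the clock `c` is `s` and the others are given by `e`. -/
def prependGap (c : κ) (s : ℝ) (e : κ × ℕ → ℝ) : κ × ℕ → ℝ
  | (c', 0) => if c' = c then s else e (c', 0)
  | (c', n + 1) => if c' = c then e (c', n) else e (c', n + 1)

lemma measurable_prependGap (c : κ) :
    Measurable fun q : ℝ × (κ × ℕ → ℝ) => prependGap c q.1 q.2 := by
  refine measurable_pi_iff.2 ?_
  rintro ⟨c', _ | n⟩ <;> simp only [prependGap] <;> split_ifs <;> fun_prop

/-- The first gap of the clock `c` is independent of the remaining gaps. -/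
lemma map_prependGap_clockLaw (c : κ) :
    ((expMeasure 1).prod (clockLaw κ)).map (fun q => prependGap c q.1 q.2) = clockLaw κ := by
  -- `none` stands for the prepended gap, `some p` for the gap of `e` with index `p`
  set σ : κ × ℕ → Option (κ × ℕ) := fun p =>
    if p.1 = c then (if p.2 = 0 then none else some (p.1, p.2 - 1)) else some p with hσ
  have hinj : Function.Injective σ := by
    rintro ⟨c₁, n₁⟩ ⟨c₂, n₂⟩ h
    simp only [hσ] at h
    grind
  have h1 := Measure.map_infinitePi_infinitePi_of_inj (P := fun _ => expMeasure 1) hinj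
  have h2 := map_option_elim_infinitePi (K := κ × ℕ) (expMeasure 1)
  have hmeas : Measurable fun (q : ℝ × (κ × ℕ → ℝ)) (o : Option (κ × ℕ)) => o.elim q.1 q.2 := by
    refine measurable_pi_iff.2 fun o => ?_
    cases o
    · exact measurable_fst
    · exact (measurable_pi_apply _).comp measurable_snd
  rw [← h2, Measure.map_map (by fun_prop) hmeas] at h1
  unfold clockLaw
  refine Eq.trans (congrArg (fun f => Measure.map f _) ?_) h1
  funext q p
  obtain ⟨c', _ | n⟩ := p <;> by_cases h : c' = c <;> simp [prependGap, hσ, h]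

/-- The gaps that remain when the clock `c` has just rung for the first time, when the clock `c'`
runs at speed `b c'`: the clock `c` starts its second gap, while a part of the first gap of the
other clocks has elapsed. -/
noncomputable def residual (b : κ → ℝ) (c : κ) (e : κ × ℕ → ℝ) : κ × ℕ → ℝ
  | (c', 0) => if c' = c then e (c, 1) else e (c', 0) - b c' / b c * e (c, 0)
  | (c', n + 1) => if c' = c then e (c, n + 2) else e (c', n + 1)

lemma measurable_residual (b : κ → ℝ) (c : κ) : Measurable (residual b c) := by
  refine measurable_pi_iff.2 ?_
  rintro ⟨c', _ | n⟩ <;> simp only [residual] <;> split_ifs <;> fun_prop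

variable [Fintype κ]

/-- Given the first gap `s` of the winning clock `c`, the first gaps of the other clocks are only
known to exceed deterministic thresholds, and by memorylessness the excesses are as good as new. -/
lemma clockLaw_prependGap_mem {b : κ → ℝ} (hb : ∀ c, 0 ≤ b c) {c : κ} (hc : 0 < b c) {s : ℝ}
    (hs : 0 < s) (S : Finset (κ × ℕ)) {t : κ × ℕ → Set ℝ} (ht : ∀ p, MeasurableSet (t p)) :
    clockLaw κ {e | prependGap c s e ∈ raceWin b c ∧ residual b c (prependGap c s e) ∈ Set.pi S t}
      = ENNReal.ofReal (Real.exp (-((∑ c' ∈ Finset.univ.erase c, b c') / b c * s))) *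
        clockLaw κ (Set.pi S t) := by
  -- the event is a box: only the factors with index in `K` (the first gaps of the losing clocks)
  -- differ from those of `Set.pi S t`, by a threshold `a` and a shift
  set K : Finset (κ × ℕ) := (Finset.univ.erase c).image fun c' => (c', 0) with hK
  set a : κ → ℝ := fun c' => b c' / b c * s with ha
  have ha0 : ∀ c', 0 ≤ a c' := fun c' => by have := hb c'; positivity
  set t₁ : κ × ℕ → Set ℝ := fun p => if p ∈ S then t p else Set.univ with ht₁
  set t₂ : κ × ℕ → Set ℝ := fun p =>
    if p ∈ K then Set.Ioi (a p.1) ∩ (fun x => x - a p.1) ⁻¹' (t₁ p) else t₁ p with ht₂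
  have ht₁m : ∀ p, MeasurableSet (t₁ p) := by
    intro p; simp only [ht₁]; split_ifs <;> simp [ht]
  have ht₂m : ∀ p, MeasurableSet (t₂ p) := by
    intro p; simp only [ht₂]; split_ifs
    · exact measurableSet_Ioi.inter ((measurable_id.sub_const _) (ht₁m p))
    · exact ht₁m p
  have hres : ∀ e p, residual b c (prependGap c s e) p = if p ∈ K then e p - a p.1 else e p := by
    rintro e ⟨c', _ | n⟩ <;> by_cases h : c' = c <;> simp [residual, prependGap, hK, h, ha]
  have hset : {e | prependGap c s e ∈ raceWin b c ∧
      residual b c (prependGap c s e) ∈ Set.pi S t} = Set.pi (S ∪ K : Finset _) t₂ := by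
    ext e
    simp only [Set.mem_ofPred_eq, raceWin, Set.mem_pi, Finset.mem_coe, hres, hc, true_and,
      Finset.mem_union]
    constructor
    · rintro ⟨h1, h2⟩ p hp
      by_cases hpK : p ∈ K
      · obtain ⟨c', hc', rfl⟩ := Finset.mem_image.1 hpK
        have h3 := h1 c' (Finset.ne_of_mem_erase hc')
        simp only [prependGap, if_true, Finset.ne_of_mem_erase hc', if_false] at h3
        simp only [ht₂, hpK, if_true, ht₁]
        refine ⟨h3, ?_⟩
        by_cases hpS : (c', 0) ∈ S
        · simpa [hpS, hpK] using h2 _ hpS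
        · simp [hpS]
      · have hpS : p ∈ S := hp.resolve_right hpK
        simpa [ht₂, hpK, ht₁, hpS] using h2 _ hpS
    · intro H
      constructor
      · intro c' hc'
        have hpK : (c', 0) ∈ K := Finset.mem_image.2 ⟨c', by simp [hc'], rfl⟩
        have := H _ (Or.inr hpK)
        simp only [ht₂, hpK, if_true] at this
        simpa [prependGap, hc'] using this.1
      · intro p hpS
        have := H _ (Or.inl hpS)
        by_cases hpK : p ∈ K
        · simp only [ht₂, hpK, if_true, ht₁, hpS] at this
          simpa [hpK] using this.2
        · simpa [ht₂, hpK, ht₁, hpS] using this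
  have hbox : clockLaw κ (Set.pi S t) = ∏ p ∈ S ∪ K, expMeasure 1 (t₁ p) := by
    rw [clockLaw, Measure.infinitePi_pi _ (fun p _ => ht p),
      ← Finset.prod_subset Finset.subset_union_left (fun p _ hp => by simp [ht₁, hp])]
    exact Finset.prod_congr rfl fun p hp => by simp [ht₁, hp]
  have hfac : ∀ p, expMeasure 1 (t₂ p)
      = (if p ∈ K then ENNReal.ofReal (Real.exp (-a p.1)) else 1) * expMeasure 1 (t₁ p) := by
    intro p
    simp only [ht₂]
    split_ifs with h
    · exact expMeasure_Ioi_inter_preimage_sub (ha0 _) (ht₁m p)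
    · rw [one_mul]
  rw [hset, hbox, clockLaw, Measure.infinitePi_pi _ (fun p _ => ht₂m p)]
  simp_rw [hfac]
  rw [Finset.prod_mul_distrib, Finset.prod_ite_mem, Finset.union_inter_cancel_right, hK,
    Finset.prod_image (by simp), ← ENNReal.ofReal_prod_of_nonneg (fun _ _ => (Real.exp_pos _).le),
    ← Real.exp_sum]
  congr 4
  simp only [ha, Finset.sum_neg_distrib, Finset.sum_div, Finset.sum_mul]

/-- The exponential race: the clock `c` rings first with probability proportional to its speed, and
given this event the remaining gaps of all clocks have their original joint law. -/
lemma map_residual_restrict_raceWin {b : κ → ℝ} (hb : ∀ c, 0 ≤ b c) (c : κ) :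
    ((clockLaw κ).restrict (raceWin b c)).map (residual b c)
      = ENNReal.ofReal (b c / ∑ c', b c') • clockLaw κ := by
  rcases (hb c).eq_or_lt with h0 | hc
  · have : raceWin b c = ∅ := by ext e; simp [raceWin, ← h0]
    simp [this, ← h0]
  set B := ∑ c', b c' with hB
  have hsplit : B = b c + ∑ c' ∈ Finset.univ.erase c, b c' :=
    (Finset.add_sum_erase _ _ (Finset.mem_univ c)).symm
  have hrest : 0 ≤ ∑ c' ∈ Finset.univ.erase c, b c' := Finset.sum_nonneg fun _ _ => hb _
  have hBpos : 0 < B := by linarith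
  have hp : 0 < b c / B := by positivity
  set q := ENNReal.ofReal (b c / B) with hq
  have hq0 : q ≠ 0 := by simpa [hq] using hp
  have hqt : q ≠ ⊤ := ENNReal.ofReal_ne_top
  have key : q⁻¹ • ((clockLaw κ).restrict (raceWin b c)).map (residual b c) = clockLaw κ := by
    refine Measure.eq_infinitePi _ fun S t ht => ?_
    have hbm : MeasurableSet (Set.pi (S : Set (κ × ℕ)) t) := .pi S.countable_toSet fun _ _ => ht _
    have hm : MeasurableSet (residual b c ⁻¹' Set.pi S t ∩ raceWin b c) :=
      (measurable_residual b c hbm).inter (measurableSet_raceWin b c)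
    rw [Measure.smul_apply, Measure.map_apply (measurable_residual b c) hbm,
      Measure.restrict_apply (measurable_residual b c hbm)]
    have h1 : clockLaw κ (residual b c ⁻¹' Set.pi S t ∩ raceWin b c)
        = q * clockLaw κ (Set.pi S t) := by
      conv_lhs => rw [← map_prependGap_clockLaw c]
      rw [Measure.map_apply (measurable_prependGap c) hm,
        Measure.prod_apply (measurable_prependGap c hm)]
      have h2 : ∀ᵐ s ∂expMeasure 1, clockLaw κ (Prod.mk s ⁻¹'
          ((fun q : ℝ × (κ × ℕ → ℝ) => prependGap c q.1 q.2) ⁻¹'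
            (residual b c ⁻¹' Set.pi S t ∩ raceWin b c)))
          = ENNReal.ofReal (Real.exp (-((∑ c' ∈ Finset.univ.erase c, b c') / b c * s))) *
            clockLaw κ (Set.pi S t) := by
        filter_upwards [ae_expMeasure_pos] with s hs
        rw [← clockLaw_prependGap_mem hb hc hs S ht]
        congr 1
        ext e
        simp [and_comm]
      rw [lintegral_congr_ae h2, lintegral_mul_const _ (by fun_prop),
        lintegral_exp_neg_mul_expMeasure (by positivity), hq]
      congr 2
      rw [hsplit, one_add_div hc.ne', one_div_div]
    rw [h1, smul_eq_mul, ← mul_assoc, ENNReal.inv_mul_cancel hq0 hqt, one_mul, clockLaw,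
      Measure.infinitePi_pi _ (fun p _ => ht p)]
  rw [← key, smul_smul, ENNReal.mul_inv_cancel hq0 hqt, one_smul, key]

/-- There is almost surely a strict winner: the winning probabilities add up to one. -/
lemma ae_exists_mem_raceWin {b : κ → ℝ} (hb : ∀ c, 0 ≤ b c) (hpos : 0 < ∑ c, b c) :
    ∀ᵐ e ∂clockLaw κ, ∃ c, e ∈ raceWin b c := by
  have hP : ∀ c, clockLaw κ (raceWin b c) = ENNReal.ofReal (b c / ∑ c', b c') := by
    intro c
    have := congrArg (fun m => m Set.univ) (map_residual_restrict_raceWin hb c)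
    simpa [Measure.map_apply (measurable_residual b c)] using this
  have hU : clockLaw κ (⋃ c, raceWin b c) = 1 := by
    rw [measure_iUnion (fun c c' h => disjoint_raceWin h) (fun c => measurableSet_raceWin b c),
      tsum_fintype]
    simp_rw [hP]
    rw [← ENNReal.ofReal_sum_of_nonneg (fun c _ => div_nonneg (hb c) hpos.le), ← Finset.sum_div,
      div_self hpos.ne', ENNReal.ofReal_one]
  have := (prob_compl_eq_zero_iff (MeasurableSet.iUnion fun c => measurableSet_raceWin b c)).2 hU
  rw [ae_iff]
  convert! this using 2
  ext e; simp

/-- What holds almost surely for fresh gaps holds almost surely for the residual gaps. -/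
lemma ae_residual {b : κ → ℝ} (hb : ∀ c, 0 ≤ b c) {p : κ → (κ × ℕ → ℝ) → Prop}
    (hp : ∀ c, ∀ᵐ e ∂clockLaw κ, p c e) :
    ∀ᵐ e ∂clockLaw κ, ∀ c, e ∈ raceWin b c → p c (residual b c e) := by
  rw [ae_all_iff]
  intro c
  rw [← ae_restrict_iff' (measurableSet_raceWin _ _)]
  refine ae_of_ae_map (measurable_residual _ _).aemeasurable ?_
  rw [map_residual_restrict_raceWin hb]
  exact Measure.ae_smul_measure (hp c) _

end Race

/-! ### The cost of hitting a state by a jump chain -/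

section HittingCost

variable {κ S : Type*} [DecidableEq κ] [Fintype κ]

open Classical in
/-- The cost accumulated up to the hitting of `y`, but over at most `n` jumps, by the jump chain
that starts in `z` and is driven by the gaps `e`: in state `z` the clock `c` runs at speed
`b z c`, the first clock `c` to ring moves the chain to `mv z c`, and each jump costs `k`. -/
noncomputable def hitCost (b : S → κ → ℝ) (mv : S → κ → S) (k : (κ × ℕ → ℝ) → ℝ≥0∞) (y : S) :
    ℕ → S → (κ × ℕ → ℝ) → ℝ≥0∞
  | 0, _, _ => 0
  | n + 1, z, e => if z = y then 0 else
      k e + ∑ c, (raceWin (b z) c).indicator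
        (fun e => hitCost b mv k y n (mv z c) (residual (b z) c e)) e

/-- The cost of the first jump from `z` and of at most `n` further jumps until `y` is hit. -/
noncomputable def returnCost (b : S → κ → ℝ) (mv : S → κ → S) (k : (κ × ℕ → ℝ) → ℝ≥0∞) (y : S)
    (n : ℕ) (z : S) (e : κ × ℕ → ℝ) : ℝ≥0∞ :=
  k e + ∑ c, (raceWin (b z) c).indicator
    (fun e => hitCost b mv k y n (mv z c) (residual (b z) c e)) e

variable {b : S → κ → ℝ} {mv : S → κ → S} {k : (κ × ℕ → ℝ) → ℝ≥0∞} {y : S}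

lemma hitCost_succ_self (n : ℕ) (e : κ × ℕ → ℝ) : hitCost b mv k y (n + 1) y e = 0 := by
  simp [hitCost]

lemma hitCost_succ_of_ne {z : S} (hz : z ≠ y) (n : ℕ) :
    hitCost b mv k y (n + 1) z = returnCost b mv k y n z := by
  funext e
  simp [hitCost, returnCost, hz]

lemma measurable_hitCost (hk : Measurable k) (n : ℕ) (z : S) :
    Measurable (hitCost b mv k y n z) := by
  induction n generalizing z with
  | zero => exact measurable_const
  | succ n ih =>
    by_cases hz : z = y
    · subst hz
      simp only [funext (hitCost_succ_self n)]
      exact measurable_const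
    · rw [hitCost_succ_of_ne hz]
      exact hk.add (Finset.measurable_fun_sum _ fun c _ =>
        ((ih _).comp (measurable_residual _ _)).indicator (measurableSet_raceWin _ _))

lemma measurable_returnCost (hk : Measurable k) (n : ℕ) (z : S) :
    Measurable (returnCost b mv k y n z) :=
  hk.add (Finset.measurable_fun_sum _ fun _ _ =>
    ((measurable_hitCost hk n _).comp (measurable_residual _ _)).indicator
      (measurableSet_raceWin _ _))

lemma hitCost_le_succ (n : ℕ) (z : S) (e : κ × ℕ → ℝ) :
    hitCost b mv k y n z e ≤ hitCost b mv k y (n + 1) z e := by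
  induction n generalizing z e with
  | zero => exact zero_le
  | succ n ih =>
    by_cases hz : z = y
    · subst hz
      rw [hitCost_succ_self]
      exact zero_le
    · rw [hitCost_succ_of_ne hz, hitCost_succ_of_ne hz]
      unfold returnCost
      gcongr with c
      exact ih _ _

lemma monotone_returnCost (z : S) : Monotone fun n => returnCost b mv k y n z := by
  refine monotone_nat_of_le_succ fun n e => ?_
  change returnCost b mv k y n z e ≤ returnCost b mv k y (n + 1) z e
  unfold returnCost
  gcongr with c
  exact hitCost_le_succ _ _ _

lemma lintegral_returnCost (hb : ∀ z c, 0 ≤ b z c) (hk : Measurable k) (n : ℕ) (z : S) :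
    ∫⁻ e, returnCost b mv k y n z e ∂clockLaw κ = ∫⁻ e, k e ∂clockLaw κ +
      ∑ c, ENNReal.ofReal (b z c / ∑ c', b z c') *
        ∫⁻ e, hitCost b mv k y n (mv z c) e ∂clockLaw κ := by
  unfold returnCost
  have hm : ∀ c, Measurable fun e => hitCost b mv k y n (mv z c) (residual (b z) c e) :=
    fun c => (measurable_hitCost hk n _).comp (measurable_residual _ _)
  rw [lintegral_add_left hk, lintegral_finsetSum _
    fun c _ => (hm c).indicator (measurableSet_raceWin _ _)]
  congr 1
  refine Finset.sum_congr rfl fun c _ => ?_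
  rw [lintegral_indicator (measurableSet_raceWin _ _),
    ← lintegral_map (measurable_hitCost hk n (mv z c)) (measurable_residual _ _),
    map_residual_restrict_raceWin (hb z), lintegral_smul_measure, smul_eq_mul]

/-- Foster's criterion: a nonnegative function `W` that decreases in expectation, by at least the
expected cost `D` of a jump, at each jump from a state other than `y` bounds the expected cost of
hitting `y`. -/
lemma lintegral_hitCost_le (hb : ∀ z c, 0 ≤ b z c) (hpos : ∀ z, 0 < ∑ c, b z c)
    (hk : Measurable k) {D : ℝ} (hD : 0 ≤ D) (hkD : ∫⁻ e, k e ∂clockLaw κ ≤ ENNReal.ofReal D)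
    {W : S → ℝ} (hW : ∀ z, 0 ≤ W z)
    (hdrift : ∀ z, z ≠ y → ∑ c, b z c * (W (mv z c) - W z) ≤ -(D * ∑ c, b z c)) (n : ℕ) (z : S) :
    ∫⁻ e, hitCost b mv k y n z e ∂clockLaw κ ≤ ENNReal.ofReal (W z) := by
  induction n generalizing z with
  | zero => simp [hitCost]
  | succ n ih =>
    by_cases hz : z = y
    · subst hz
      simp [hitCost_succ_self]
    · rw [hitCost_succ_of_ne hz, lintegral_returnCost hb hk]
      set B := ∑ c, b z c with hB
      have hBpos : 0 < B := hpos z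
      calc _ ≤ ENNReal.ofReal D
            + ∑ c, ENNReal.ofReal (b z c / B) * ENNReal.ofReal (W (mv z c)) := by
            gcongr with c
            exact ih _
        _ = ENNReal.ofReal (D + ∑ c, b z c / B * W (mv z c)) := by
            have h0 : ∀ c, 0 ≤ b z c / B := fun c => div_nonneg (hb z c) hBpos.le
            rw [ENNReal.ofReal_add hD (Finset.sum_nonneg fun c _ => mul_nonneg (h0 c) (hW _)),
              ENNReal.ofReal_sum_of_nonneg fun c _ => mul_nonneg (h0 c) (hW _)]
            simp_rw [ENNReal.ofReal_mul (h0 _)]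
        _ ≤ ENNReal.ofReal (W z) := by
            apply ENNReal.ofReal_le_ofReal
            have h1 := hdrift z hz
            simp only [mul_sub, Finset.sum_sub_distrib, ← Finset.sum_mul, ← hB] at h1
            simp only [div_mul_eq_mul_div, ← Finset.sum_div]
            rw [← le_sub_iff_add_le', div_le_iff₀ hBpos]
            linarith

lemma lintegral_iSup_returnCost_lt_top (hb : ∀ z c, 0 ≤ b z c) (hpos : ∀ z, 0 < ∑ c, b z c)
    (hk : Measurable k) {D : ℝ} (hD : 0 ≤ D) (hkD : ∫⁻ e, k e ∂clockLaw κ ≤ ENNReal.ofReal D)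
    {W : S → ℝ} (hW : ∀ z, 0 ≤ W z)
    (hdrift : ∀ z, z ≠ y → ∑ c, b z c * (W (mv z c) - W z) ≤ -(D * ∑ c, b z c)) (z : S) :
    ∫⁻ e, ⨆ n, returnCost b mv k y n z e ∂clockLaw κ < ⊤ := by
  rw [lintegral_iSup (fun n => measurable_returnCost hk n z) (monotone_returnCost z)]
  refine lt_of_le_of_lt (iSup_le fun n => ?_) (?_ : ENNReal.ofReal D +
    ∑ c, ENNReal.ofReal (b z c / ∑ c', b z c') * ENNReal.ofReal (W (mv z c)) < ⊤)
  · rw [lintegral_returnCost hb hk]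
    gcongr with c
    exact lintegral_hitCost_le hb hpos hk hD hkD hW hdrift n _
  · exact ENNReal.add_lt_top.2 ⟨ENNReal.ofReal_lt_top, ENNReal.sum_lt_top.2 fun c _ =>
      ENNReal.mul_lt_top ENNReal.ofReal_lt_top ENNReal.ofReal_lt_top⟩

end HittingCost

/-! ### Paths driven by clocks and their first jump -/

section RenewalCount

lemma renewalCount_eq_zero {u : ℕ → ℝ} (hu : ∀ n, 0 < u n) {t : ℝ} (ht : t < u 0) :
    renewalCount u t = 0 := by
  have : {n : ℕ | ∑ k ∈ Finset.range (n + 1), u k ≤ t} = ∅ := by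
    ext n
    simp only [Set.mem_ofPred_eq, Set.mem_empty_iff_false, iff_false, not_le]
    rw [Finset.sum_range_succ']
    have := Finset.sum_nonneg fun k (_ : k ∈ Finset.range n) => (hu (k + 1)).le
    linarith
  rw [renewalCount, this, Set.ncard_empty]

lemma renewalCount_sub {u u' : ℕ → ℝ} {a : ℝ} (h0 : u' 0 = u 0 - a)
    (hs : ∀ n, u' (n + 1) = u (n + 1)) (t : ℝ) :
    renewalCount u' t = renewalCount u (a + t) := by
  unfold renewalCount
  congr 1
  ext n
  simp only [Set.mem_ofPred_eq, Finset.sum_range_succ' _ n, h0, hs]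
  constructor <;> intro h <;> linarith

/-- Finiteness matters because the cardinality of an infinite set of events would be zero. -/
lemma renewalCount_tail {u : ℕ → ℝ} {t : ℝ} (ht : 0 ≤ t)
    (hfin : {n : ℕ | ∑ k ∈ Finset.range (n + 1), u k ≤ u 0 + t}.Finite) :
    renewalCount u (u 0 + t) = renewalCount (fun n => u (n + 1)) t + 1 := by
  unfold renewalCount
  have h : {n : ℕ | ∑ k ∈ Finset.range (n + 1), u k ≤ u 0 + t}
      = insert 0 (Nat.succ '' {n : ℕ | ∑ k ∈ Finset.range (n + 1), u (k + 1) ≤ t}) := by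
    ext n
    cases n with
    | zero => simp [ht]
    | succ n =>
      simp only [Set.mem_ofPred_eq, Set.mem_insert_iff, Set.mem_image,
        Finset.sum_range_succ' _ (n + 1), Nat.succ_eq_add_one, Nat.add_right_cancel_iff,
        exists_eq_right]
      constructor
      · intro h; right; linarith
      · rintro (h | h)
        · omega
        · linarith
  rw [h] at hfin ⊢
  rw [Set.ncard_insert_of_notMem (by simp) (hfin.subset (Set.subset_insert _ _)),
    Set.ncard_image_of_injective _ Nat.succ_injective]

end RenewalCount

/-- A real function of a path with right-continuous (for the discrete topology of the state space)
values is measurable: it is the limit of functions of the values on finer and finer grids. -/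
lemma measurable_comp_of_rightCont {S : Type*} {Y : ℝ → S}
    (hY : ∀ t, ∀ᶠ s in 𝓝[≥] t, Y s = Y t) (F : S → ℝ) : Measurable fun t => F (Y t) := by
  set r : ℕ → ℝ → ℝ := fun n t => ((⌊((n : ℝ) + 1) * t⌋ : ℝ) + 1) / ((n : ℝ) + 1) with hr
  refine measurable_of_tendsto_metrizable (f := fun n t => F (Y (r n t))) (fun n => ?_) ?_
  · have : (fun t => F (Y (r n t)))
        = (fun m : ℤ => F (Y (((m : ℝ) + 1) / ((n : ℝ) + 1)))) ∘ fun t => ⌊((n : ℝ) + 1) * t⌋ := rfl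
    rw [this]
    exact measurable_from_top.comp (Int.measurable_floor.comp (measurable_const_mul _))
  · rw [tendsto_pi_nhds]
    intro t
    have hlow : ∀ n, t ≤ r n t := by
      intro n
      have hn : (0 : ℝ) < (n : ℝ) + 1 := by positivity
      rw [hr, le_div_iff₀ hn, mul_comm]
      exact (Int.lt_floor_add_one _).le
    have hup : ∀ n, r n t ≤ t + 1 / ((n : ℝ) + 1) := by
      intro n
      have hn : (0 : ℝ) < (n : ℝ) + 1 := by positivity
      have h1 : (t + 1 / ((n : ℝ) + 1)) * ((n : ℝ) + 1) = ((n : ℝ) + 1) * t + 1 := by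
        field_simp
      rw [hr, div_le_iff₀ hn, h1]
      gcongr
      exact Int.floor_le _
    have hlim : Tendsto (fun n : ℕ => t + 1 / ((n : ℝ) + 1)) atTop (𝓝 t) := by
      simpa using tendsto_const_nhds.add (tendsto_one_div_add_atTop_nhds_zero_nat (𝕜 := ℝ))
    have hrt : Tendsto (fun n => r n t) atTop (𝓝[≥] t) :=
      tendsto_nhdsWithin_iff.2
        ⟨tendsto_of_tendsto_of_tendsto_of_le_of_le tendsto_const_nhds hlim hlow hup,
          Eventually.of_forall hlow⟩
    exact tendsto_const_nhds.congr' ((hrt.eventually (hY t)).mono fun n hn => congrArg F hn.symm)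

section Network

variable {ι : Type*}

/-- The speeds of the arrival clocks (`Sum.inl`) and of the departure clocks (`Sum.inr`). -/
def clockRate (lam : ι → ℝ) (ψ : (ι → ℕ) → ι → ℝ) (z : ι → ℕ) : ι ⊕ ι → ℝ :=
  Sum.elim lam (ψ z)

/-- The state after an arrival into (`Sum.inl`) or a departure from (`Sum.inr`) a queue. -/
def jump [DecidableEq ι] (z : ι → ℕ) : ι ⊕ ι → ι → ℕ :=
  Sum.elim (fun i => Function.update z i (z i + 1)) (fun i => Function.update z i (z i - 1))

/-- The time elapsed on a clock until time `t` along the path `Y`. -/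
noncomputable def elapsed (lam : ι → ℝ) (ψ : (ι → ℕ) → ι → ℝ) (Y : ℝ → ι → ℕ) (c : ι ⊕ ι)
    (t : ℝ) : ℝ :=
  ∫ τ in (0 : ℝ)..t, clockRate lam ψ (Y τ) c

/-- `Y` is a right-continuous path of queue lengths that starts in `z` and is driven by the
gaps `e`. -/
structure IsPath (lam : ι → ℝ) (ψ : (ι → ℕ) → ι → ℝ) (z : ι → ℕ) (e : (ι ⊕ ι) × ℕ → ℝ)
    (Y : ℝ → ι → ℕ) : Prop where
  rightCont : ∀ t, 0 ≤ t → ∀ᶠ s in 𝓝[≥] t, Y s = Y t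
  balance : ∀ t, 0 ≤ t → ∀ i,
    Y t i + renewalCount (fun n => e (.inr i, n)) (elapsed lam ψ Y (.inr i) t)
      = z i + renewalCount (fun n => e (.inl i, n)) (elapsed lam ψ Y (.inl i) t)

/-- The gaps are positive and no clock rings infinitely often in finite time. -/
structure RegularGaps {κ : Type*} (e : κ × ℕ → ℝ) : Prop where
  pos : ∀ c n, 0 < e (c, n)
  finite : ∀ c t, {n : ℕ | ∑ k ∈ Finset.range (n + 1), e (c, k) ≤ t}.Finite

lemma residual_pos {κ : Type*} [DecidableEq κ] {b : κ → ℝ} {c : κ} {e : κ × ℕ → ℝ}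
    (he : ∀ c n, 0 < e (c, n)) (hc : e ∈ raceWin b c) (c' : κ) (n : ℕ) :
    0 < residual b c e (c', n) := by
  cases n <;> by_cases h : c' = c
  · simp [residual, h, he]
  · simpa [residual, h] using hc.2 c' h
  · simp [residual, h, he]
  · simp [residual, h, he]

/-- When the clock `c` wins the race, the counts of all clocks restart with the residual gaps after
the first ring of `c`, which occurs at time `e (c, 0) / b c`. -/
lemma renewalCount_residual {κ : Type*} [DecidableEq κ] {b : κ → ℝ} {c : κ} {e : κ × ℕ → ℝ}
    (he : RegularGaps e) (hc : e ∈ raceWin b c) (c' : κ) {t : ℝ} (ht : 0 ≤ t) :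
    renewalCount (fun n => e (c', n)) (b c' * (e (c, 0) / b c) + t)
      = renewalCount (fun n => residual b c e (c', n)) t + if c' = c then 1 else 0 := by
  have hbc : b c ≠ 0 := hc.1.ne'
  split_ifs with h
  · subst h
    rw [mul_div_cancel₀ _ hbc]
    rw [renewalCount_tail (u := fun n => e (c', n)) ht (he.finite _ _)]
    congr 2
    funext n
    cases n <;> simp [residual]
  · exact (renewalCount_sub (u := fun n => e (c', n)) (u' := fun n => residual b c e (c', n))
      (by simp [residual, h]; ring) (by simp [residual, h]) t).symm

variable {lam : ι → ℝ} {ψ : (ι → ℕ) → ι → ℝ} {z : ι → ℕ} {e : (ι ⊕ ι) × ℕ → ℝ} {Y : ℝ → ι → ℕ}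

lemma elapsed_eq_mul_of_forall_lt {t : ℝ} (ht : 0 ≤ t) (hY : ∀ s, 0 ≤ s → s < t → Y s = z)
    (c : ι ⊕ ι) : elapsed lam ψ Y c t = clockRate lam ψ z c * t := by
  have : elapsed lam ψ Y c t = ∫ _ in (0 : ℝ)..t, clockRate lam ψ z c := by
    unfold elapsed
    rw [intervalIntegral.integral_of_le ht, intervalIntegral.integral_of_le ht,
      integral_Ioc_eq_integral_Ioo, integral_Ioc_eq_integral_Ioo]
    exact setIntegral_congr_fun measurableSet_Ioo fun s hs => by simp only [hY s hs.1.le hs.2]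
  rw [this]
  simp [mul_comm]

lemma IsPath.apply_zero (h : IsPath lam ψ z e Y) (he : ∀ c n, 0 < e (c, n)) : Y 0 = z := by
  funext i
  have := h.balance 0 le_rfl i
  simpa [elapsed, renewalCount_eq_zero, he] using this

/-- Until the first clock rings, the path stays in its initial state. -/
lemma IsPath.eq_initial (h : IsPath lam ψ z e Y) (he : ∀ c n, 0 < e (c, n)) {T : ℝ}
    (hT : ∀ t, 0 ≤ t → t < T → ∀ c, clockRate lam ψ z c * t < e (c, 0)) {t : ℝ} (ht : 0 ≤ t)
    (htT : t < T) : Y t = z := by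
  by_contra hne
  -- up to the infimum of the exceptional times no clock rings, so by right-continuity the path also
  -- stays in `z` for a while after it
  set B := {s | 0 ≤ s ∧ s < T ∧ Y s ≠ z} with hB
  have hBne : B.Nonempty := ⟨t, ht, htT, hne⟩
  have hBbdd : BddBelow B := ⟨0, fun s hs => hs.1⟩
  have h0 : 0 ≤ sInf B := le_csInf hBne fun s hs => hs.1
  have hlt : sInf B < T := (csInf_le hBbdd ⟨ht, htT, hne⟩).trans_lt htT
  have hbefore : ∀ s, 0 ≤ s → s < sInf B → Y s = z := by
    intro s hs hsB
    by_contra hs'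
    exact (csInf_le hBbdd ⟨hs, hsB.trans hlt, hs'⟩).not_gt hsB
  have hat : Y (sInf B) = z := by
    funext i
    have := h.balance _ h0 i
    rwa [elapsed_eq_mul_of_forall_lt h0 hbefore, elapsed_eq_mul_of_forall_lt h0 hbefore,
      renewalCount_eq_zero (he _) (hT _ h0 hlt _), renewalCount_eq_zero (he _) (hT _ h0 hlt _)]
      at this
  have hev := h.rightCont _ h0
  rw [hat, eventually_nhdsWithin_iff, Metric.eventually_nhds_iff] at hev
  obtain ⟨ε, hε, hball⟩ := hev
  obtain ⟨s, hsB, hs⟩ := exists_lt_of_csInf_lt hBne (lt_add_of_pos_right (sInf B) hε)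
  have hle := csInf_le hBbdd hsB
  refine hsB.2.2 (hball ?_ hle)
  rw [Real.dist_eq, abs_of_nonneg (by linarith)]
  linarith

lemma IsPath.intervalIntegrable (h : IsPath lam ψ z e Y) {M : ℝ} (hM : ∀ z i, |ψ z i| ≤ M)
    (c : ι ⊕ ι) {s t : ℝ} (hs : 0 ≤ s) (hst : s ≤ t) :
    IntervalIntegrable (fun τ => clockRate lam ψ (Y τ) c) volume s t := by
  cases c with
  | inl i => exact intervalIntegrable_const
  | inr i =>
    have hmeas : Measurable fun τ => ψ (Y (max τ 0)) i := by
      refine measurable_comp_of_rightCont (Y := fun τ => Y (max τ 0)) (fun τ => ?_)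
        (fun z => ψ z i)
      rcases lt_or_ge τ 0 with hτ | hτ
      · filter_upwards [mem_nhdsWithin_of_mem_nhds (Iio_mem_nhds hτ)] with s hs
        rw [max_eq_right hτ.le, max_eq_right (le_of_lt hs)]
      · filter_upwards [h.rightCont τ hτ, self_mem_nhdsWithin] with s hs hs'
        rw [max_eq_left hτ, max_eq_left (hτ.trans hs'), hs]
    have hint : IntervalIntegrable (fun τ => ψ (Y (max τ 0)) i) volume s t := by
      rw [intervalIntegrable_iff]
      exact Measure.integrableOn_of_bounded (M := M) (by simp) hmeas.aestronglyMeasurable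
        (Eventually.of_forall fun τ => hM _ _)
    refine hint.congr fun τ hτ => ?_
    rw [Set.uIoc_of_le hst] at hτ
    simp [clockRate, max_eq_left (hs.trans hτ.1.le)]

lemma elapsed_nonneg (hlam : ∀ i, 0 ≤ lam i) (hψ : ∀ z i, 0 ≤ ψ z i) (c : ι ⊕ ι) {t : ℝ}
    (ht : 0 ≤ t) : 0 ≤ elapsed lam ψ Y c t := by
  refine intervalIntegral.integral_nonneg ht fun τ _ => ?_
  cases c
  · exact hlam _
  · exact hψ _ _

variable [DecidableEq ι]

/-- The first jump of a path: if the clock `c` wins the race, the path jumps at time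
`e (c, 0) / clockRate lam ψ z c` into the state `jump z c`, and from then on it is a path driven by
the residual gaps. -/
lemma IsPath.firstJump (h : IsPath lam ψ z e Y) (he : RegularGaps e) (hlam : ∀ i, 0 ≤ lam i)
    (hψ : ∀ z i, 0 ≤ ψ z i) {M : ℝ} (hM : ∀ z i, ψ z i ≤ M) {c : ι ⊕ ι}
    (hc : e ∈ raceWin (clockRate lam ψ z) c) :
    jump z c ≠ z ∧
      IsPath lam ψ (jump z c) (residual (clockRate lam ψ z) c e)
        (fun s => Y (e (c, 0) / clockRate lam ψ z c + s)) := by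
  set b := clockRate lam ψ z with hb
  set T := e (c, 0) / b c with hTdef
  have hbc : 0 < b c := hc.1
  have hb0 : ∀ c, 0 ≤ b c := by
    rintro (i | i)
    · exact hlam i
    · exact hψ z i
  have hT : 0 < T := div_pos (he.pos c 0) hbc
  have hbefore : ∀ t, 0 ≤ t → t < T → Y t = z := by
    intro t ht htT
    refine h.eq_initial he.pos (T := T) (fun s hs hsT c' => ?_) ht htT
    have h1 : b c * s < e (c, 0) := by rwa [hTdef, lt_div_iff₀ hbc, mul_comm] at hsT
    by_cases hcc : c' = c
    · rwa [hcc]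
    · refine lt_of_le_of_lt ?_ (hc.2 c' hcc)
      change b c' * s ≤ b c' / b c * e (c, 0)
      rw [div_mul_eq_mul_div, mul_div_assoc]
      exact mul_le_mul_of_nonneg_left hsT.le (hb0 c')
  have hadd : ∀ s, 0 ≤ s → ∀ c', elapsed lam ψ Y c' (T + s)
      = b c' * T + elapsed lam ψ (fun s => Y (T + s)) c' s := by
    intro s hs c'
    have hM' : ∀ z i, |ψ z i| ≤ M := fun z i => by rw [abs_of_nonneg (hψ z i)]; exact hM z i
    rw [← elapsed_eq_mul_of_forall_lt hT.le hbefore]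
    unfold elapsed
    rw [← intervalIntegral.integral_add_adjacent_intervals
      (h.intervalIntegrable hM' c' le_rfl hT.le)
      (h.intervalIntegrable hM' c' hT.le (by linarith : T ≤ T + s)),
      intervalIntegral.integral_comp_add_left (fun τ => clockRate lam ψ (Y τ) c'), add_zero]
  have hbal : ∀ s, 0 ≤ s → ∀ i,
      Y (T + s) i + (renewalCount (fun n => residual b c e (.inr i, n))
          (elapsed lam ψ (fun s => Y (T + s)) (.inr i) s) + if Sum.inr i = c then 1 else 0)
        = z i + (renewalCount (fun n => residual b c e (.inl i, n))
          (elapsed lam ψ (fun s => Y (T + s)) (.inl i) s) + if Sum.inl i = c then 1 else 0) := by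
    intro s hs i
    rw [← renewalCount_residual he hc _ (elapsed_nonneg hlam hψ _ hs),
      ← renewalCount_residual he hc _ (elapsed_nonneg hlam hψ _ hs), ← hTdef, ← hadd s hs,
      ← hadd s hs]
    exact h.balance _ (by linarith) i
  -- a queue with a departure was not empty
  have hdep : ∀ i, c = Sum.inr i → 1 ≤ z i := by
    intro i hi
    have h0 := hbal 0 le_rfl i
    have hz : ∀ c', elapsed lam ψ (fun s => Y (T + s)) c' 0 = 0 := fun c' => by simp [elapsed]
    rw [hz, hz, renewalCount_eq_zero (residual_pos he.pos hc _) (residual_pos he.pos hc _ _),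
      renewalCount_eq_zero (residual_pos he.pos hc _) (residual_pos he.pos hc _ _)] at h0
    simp only [hi, if_true, reduceCtorEq, if_false] at h0
    omega
  refine ⟨?_, ?_, ?_⟩
  · rcases c with i | i
    · intro heq
      have := congrFun heq i
      simp [jump] at this
    · intro heq
      have := congrFun heq i
      have := hdep i rfl
      simp [jump] at *
      omega
  · intro t ht
    have h1 := h.rightCont (T + t) (by linarith)
    have h2 : Tendsto (fun s => T + s) (𝓝[≥] t) (𝓝[≥] (T + t)) := by
      refine tendsto_nhdsWithin_iff.2 ⟨?_, ?_⟩
      · exact ((continuous_const_add T).tendsto t).mono_left nhdsWithin_le_nhds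
      · filter_upwards [self_mem_nhdsWithin] with s hs
        have : t ≤ s := hs
        simpa using this
    exact h2.eventually h1
  · intro s hs i
    have h0 := hbal s hs i
    rcases c with j | j
    · rcases eq_or_ne i j with rfl | hij
      · simp [jump] at h0 ⊢
        omega
      · simpa [jump, hij] using h0
    · rcases eq_or_ne i j with rfl | hij
      · have := hdep i rfl
        simp [jump] at h0 ⊢
        omega
      · simpa [jump, hij] using h0

end Network

/-! ### Return times are dominated by hitting costs -/

/-- By the strong law of large numbers the ring times of each clock tend to infinity. -/
lemma ae_regularGaps (κ : Type*) [Countable κ] : ∀ᵐ e ∂clockLaw κ, RegularGaps e := by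
  have heval : ∀ p : κ × ℕ,
      MeasurePreserving (fun e : κ × ℕ → ℝ => e p) (clockLaw κ) (expMeasure 1) :=
    fun p => measurePreserving_eval_infinitePi (fun _ => expMeasure 1) p
  have hpos : ∀ᵐ e ∂clockLaw κ, ∀ p, 0 < e p := by
    rw [ae_all_iff]
    exact fun p => (heval p).quasiMeasurePreserving.ae ae_expMeasure_pos
  have hint : Integrable (fun s : ℝ => s) (expMeasure 1) := by
    refine ⟨measurable_id.aestronglyMeasurable, ?_⟩
    rw [hasFiniteIntegral_iff_ofReal (ae_expMeasure_pos.mono fun s hs => hs.le)]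
    exact lintegral_ofReal_expMeasure_lt_top
  have hmean : 0 < ∫ s, s ∂expMeasure 1 := by
    rw [integral_pos_iff_support_of_nonneg_ae (ae_expMeasure_pos.mono fun s hs => hs.le) hint]
    refine lt_of_lt_of_eq one_pos (Eq.symm ?_)
    exact (prob_compl_eq_zero_iff (measurableSet_support measurable_id)).1
      (mem_ae_iff.1 (ae_expMeasure_pos.mono fun s hs => hs.ne'))
  have hlln : ∀ᵐ e ∂clockLaw κ, ∀ c, Tendsto (fun n : ℕ => (∑ k ∈ Finset.range n, e (c, k)) / (n : ℝ))
      atTop (𝓝 (∫ s, s ∂expMeasure 1)) := by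
    refine ae_all_iff.2 fun c => ?_
    have hindep : iIndepFun (fun (p : κ × ℕ) (e : κ × ℕ → ℝ) => e p) (clockLaw κ) :=
      iIndepFun_infinitePi (X := fun _ s => s) fun _ => measurable_id
    have h := strong_law_ae_real (μ := clockLaw κ) (fun k e => e (c, k))
      ((heval (c, 0)).integrable_comp_of_integrable hint)
      (fun k l hkl => hindep.indepFun (by simpa using hkl))
      (fun k => ⟨(heval _).measurable.aemeasurable, (heval _).measurable.aemeasurable,
        by rw [(heval _).map_eq, (heval _).map_eq]⟩)
    have hmap : ∫ e, e (c, 0) ∂clockLaw κ = ∫ s, s ∂expMeasure 1 := by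
      rw [← (heval (c, 0)).map_eq, integral_map (f := fun s : ℝ => s)
        (heval (c, 0)).measurable.aemeasurable measurable_id.aestronglyMeasurable]
    rwa [hmap] at h
  filter_upwards [hpos, hlln] with e h1 h2
  refine ⟨fun c n => h1 _, fun c t => ?_⟩
  have h3 : Tendsto (fun n : ℕ => ∑ k ∈ Finset.range n, e (c, k)) atTop atTop := by
    refine ((h2 c).pos_mul_atTop hmean tendsto_natCast_atTop_atTop).congr' ?_
    filter_upwards [eventually_gt_atTop 0] with n hn
    exact div_mul_cancel₀ _ (by positivity)
  have h4 := ((tendsto_add_atTop_iff_nat 1).2 h3).eventually (eventually_gt_atTop t)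
  obtain ⟨N, hN⟩ := eventually_atTop.1 h4
  refine (Set.finite_lt_nat N).subset fun n hn => ?_
  by_contra hlt
  exact (hN n (not_lt.1 hlt)).not_ge hn

section Hitting

variable {ι : Type*} {lam : ι → ℝ} {ψ : (ι → ℕ) → ι → ℝ}

lemma clockRate_nonneg (hlam : ∀ i, 0 < lam i) (hψ : ∀ z i, 0 ≤ ψ z i) (z : ι → ℕ) (c : ι ⊕ ι) :
    0 ≤ clockRate lam ψ z c := by
  cases c
  · exact (hlam _).le
  · exact hψ _ _

lemma sum_clockRate_pos [Fintype ι] [Nonempty ι] (hlam : ∀ i, 0 < lam i) (hψ : ∀ z i, 0 ≤ ψ z i)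
    (z : ι → ℕ) : 0 < ∑ c, clockRate lam ψ z c :=
  Finset.sum_pos' (fun c _ => clockRate_nonneg hlam hψ z c)
    ⟨Sum.inl (Classical.arbitrary ι), Finset.mem_univ _, hlam _⟩

/-- The cost of a jump: one for the jump itself, which makes the total cost infinite if the target
is never hit, and an upper bound on the time until the first clock rings, namely the time until the
arrival clock of queue `i` does. -/
noncomputable def jumpCost (lam : ι → ℝ) (i : ι) (e : (ι ⊕ ι) × ℕ → ℝ) : ℝ≥0∞ :=
  1 + ENNReal.ofReal (e (.inl i, 0) / lam i)

lemma measurable_jumpCost (lam : ι → ℝ) (i : ι) : Measurable (jumpCost lam i) := by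
  unfold jumpCost; fun_prop

lemma lintegral_jumpCost_lt_top {i : ι} (hi : 0 < lam i) :
    ∫⁻ e, jumpCost lam i e ∂clockLaw (ι ⊕ ι) < ⊤ := by
  have heval : MeasurePreserving (fun e : (ι ⊕ ι) × ℕ → ℝ => e (.inl i, 0)) (clockLaw (ι ⊕ ι))
      (expMeasure 1) := measurePreserving_eval_infinitePi (fun _ => expMeasure 1) _
  unfold jumpCost
  rw [lintegral_add_left measurable_const, lintegral_const, measure_univ]
  refine ENNReal.add_lt_top.2 ⟨by simp, ?_⟩
  simp_rw [div_eq_mul_inv, ENNReal.ofReal_mul' (inv_nonneg.2 hi.le)]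
  rw [lintegral_mul_const _ (by fun_prop)]
  refine ENNReal.mul_lt_top ?_ ENNReal.ofReal_lt_top
  rw [heval.lintegral_comp (f := fun s => ENNReal.ofReal s) (by fun_prop)]
  exact lintegral_ofReal_expMeasure_lt_top

lemma ofReal_div_le_jumpCost {z : ι → ℕ} {i : ι}
    (hi : 0 < lam i) {e : (ι ⊕ ι) × ℕ → ℝ} {c : ι ⊕ ι} (hc : e ∈ raceWin (clockRate lam ψ z) c) :
    1 + ENNReal.ofReal (e (c, 0) / clockRate lam ψ z c) ≤ jumpCost lam i e := by
  unfold jumpCost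
  gcongr 1 + ENNReal.ofReal ?_
  by_cases h : Sum.inl i = c
  · subst h
    rfl
  · have h1 := (hc.2 _ h).le
    change lam i / _ * _ ≤ _ at h1
    rw [le_div_iff₀ hi]
    calc _ = lam i / clockRate lam ψ z c * e (c, 0) := by ring
      _ ≤ _ := h1

variable [Fintype ι] [DecidableEq ι]

lemma jumpCost_add_hitCost_le {z : ι → ℕ} {i : ι} {y : ι → ℕ} {e : (ι ⊕ ι) × ℕ → ℝ} {c : ι ⊕ ι}
    (hc : e ∈ raceWin (clockRate lam ψ z) c) (n : ℕ) :
    jumpCost lam i e + hitCost (clockRate lam ψ) jump (jumpCost lam i) y n (jump z c)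
        (residual (clockRate lam ψ z) c e)
      ≤ returnCost (clockRate lam ψ) jump (jumpCost lam i) y n z e := by
  unfold returnCost
  gcongr
  refine le_trans (le_of_eq ?_) (Finset.single_le_sum
    (f := fun c => (raceWin (clockRate lam ψ z) c).indicator (fun e =>
      hitCost (clockRate lam ψ) jump (jumpCost lam i) y n (jump z c)
        (residual (clockRate lam ψ z) c e)) e) (fun _ _ => zero_le) (Finset.mem_univ c))
  rw [Set.indicator_of_mem hc]

/-- The cost of hitting `y` from `z` over at most `n` jumps either dominates a time at which the
path is in `y` or, when these jumps do not lead to `y`, is at least `n`. -/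
def HitsOrCostly (lam : ι → ℝ) (ψ : (ι → ℕ) → ι → ℝ) (i : ι) (y : ι → ℕ) (n : ℕ) (z : ι → ℕ)
    (e : (ι ⊕ ι) × ℕ → ℝ) : Prop :=
  ∀ Y, IsPath lam ψ z e Y →
    (∃ t, 0 ≤ t ∧ Y t = y ∧
      ENNReal.ofReal t ≤ hitCost (clockRate lam ψ) jump (jumpCost lam i) y n z e) ∨
    (n : ℝ≥0∞) ≤ hitCost (clockRate lam ψ) jump (jumpCost lam i) y n z e

variable [Nonempty ι] {M : ℝ}

lemma ae_hitsOrCostly (hlam : ∀ i, 0 < lam i) (hψ : ∀ z i, 0 ≤ ψ z i) (hM : ∀ z i, ψ z i ≤ M)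
    (i : ι) (y : ι → ℕ) (n : ℕ) (z : ι → ℕ) :
    ∀ᵐ e ∂clockLaw (ι ⊕ ι), HitsOrCostly lam ψ i y n z e := by
  induction n generalizing z with
  | zero => exact Eventually.of_forall fun e Y _ => Or.inr (by simp)
  | succ n ih =>
    have hb := clockRate_nonneg hlam hψ
    filter_upwards [ae_regularGaps (ι ⊕ ι), ae_residual (hb z) fun c => ih (jump z c),
      ae_exists_mem_raceWin (hb z) (sum_clockRate_pos hlam hψ z)] with e he hnext ⟨c, hc⟩ Y hY
    obtain ⟨-, hYc⟩ := hY.firstJump he (fun i => (hlam i).le) hψ hM hc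
    by_cases hz : z = y
    · exact Or.inl ⟨0, le_rfl, (hY.apply_zero he.pos).trans hz, by simp⟩
    · rw [hitCost_succ_of_ne hz]
      have hk := ofReal_div_le_jumpCost (i := i) (hlam i) hc
      refine (hnext c hc _ hYc).imp ?_ ?_
      · rintro ⟨t, ht0, ht, htle⟩
        have hT : 0 ≤ e (c, 0) / clockRate lam ψ z c := div_nonneg (he.pos _ _).le (hb _ _)
        refine ⟨_, add_nonneg hT ht0, ht, ?_⟩
        rw [ENNReal.ofReal_add hT ht0]
        exact (add_le_add (le_add_self.trans hk) htle).trans (jumpCost_add_hitCost_le hc n)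
      · intro hn
        rw [Nat.cast_succ, add_comm]
        exact (add_le_add (le_self_add.trans hk) hn).trans (jumpCost_add_hitCost_le hc n)

/-- As each jump costs at least one, a finite total cost means that `y` is hit. -/
lemma ae_forall_isPath_returnTime_le (hlam : ∀ i, 0 < lam i) (hψ : ∀ z i, 0 ≤ ψ z i)
    (hM : ∀ z i, ψ z i ≤ M) (i : ι) (y z : ι → ℕ) :
    ∀ᵐ e ∂clockLaw (ι ⊕ ι), ∀ Y, IsPath lam ψ z e Y → returnTime Y y ≤
      ⨆ n, returnCost (clockRate lam ψ) jump (jumpCost lam i) y n z e := by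
  have hb := clockRate_nonneg hlam hψ
  filter_upwards [ae_regularGaps (ι ⊕ ι),
    ae_residual (hb z) fun c => ae_all_iff.2 fun n => ae_hitsOrCostly hlam hψ hM i y n (jump z c),
    ae_exists_mem_raceWin (hb z) (sum_clockRate_pos hlam hψ z)] with e he hnext ⟨c, hc⟩ Y hY
  obtain ⟨hne, hYc⟩ := hY.firstJump he (fun i => (hlam i).le) hψ hM hc
  set R := ⨆ n, returnCost (clockRate lam ψ) jump (jumpCost lam i) y n z e with hR
  rcases eq_or_ne R ⊤ with hRt | hRt
  · rw [hRt]; exact le_top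
  have hle : ∀ n, jumpCost lam i e + hitCost (clockRate lam ψ) jump (jumpCost lam i) y n (jump z c)
      (residual (clockRate lam ψ z) c e) ≤ R := fun n =>
    (jumpCost_add_hitCost_le hc n).trans (le_iSup (fun n => returnCost (clockRate lam ψ) jump
      (jumpCost lam i) y n z e) n)
  obtain ⟨n, hn⟩ := ENNReal.exists_nat_gt hRt
  rcases hnext c hc n _ hYc with ⟨t, ht0, ht, htle⟩ | hn'
  · have hT : 0 ≤ e (c, 0) / clockRate lam ψ z c := div_nonneg (he.pos _ _).le (hb _ _)
    have hYT : Y (e (c, 0) / clockRate lam ψ z c) = jump z c := by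
      simpa using hYc.apply_zero (residual_pos he.pos hc)
    refine (iInf₂_le (e (c, 0) / clockRate lam ψ z c + t) ⟨add_nonneg hT ht0, ht,
      e (c, 0) / clockRate lam ψ z c, ⟨hT, by linarith⟩, ?_⟩).trans ?_
    · rw [ENNReal.ofReal_add hT ht0]
      exact (add_le_add (le_add_self.trans (ofReal_div_le_jumpCost (hlam i) hc)) htle).trans (hle n)
    · rw [hY.apply_zero he.pos, hYT]; exact hne
  · exact absurd ((hn'.trans le_add_self).trans (hle n)) hn.not_ge

end Hitting

/-! ### Lyapunov functions with negative drift off one state -/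

section Foster

variable {κ S : Type*} [Fintype κ]

open Classical in
/-- The expectation of `2 ^ (-τ)` over `τ ≤ n`, where `τ` is the number of jumps that the chain with
rates `b` and moves `mv` makes from `z` until it hits `y`. -/
noncomputable def discountedHit (b : S → κ → ℝ) (mv : S → κ → S) (y : S) : ℕ → S → ℝ
  | 0, z => if z = y then 1 else 0
  | n + 1, z => if z = y then 1 else
      (∑ c, b z c * discountedHit b mv y n (mv z c)) / (2 * ∑ c, b z c)

variable {b : S → κ → ℝ} {mv : S → κ → S} {y : S}

lemma discountedHit_self (n : ℕ) : discountedHit b mv y n y = 1 := by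
  cases n <;> simp [discountedHit]

lemma discountedHit_succ_of_ne {z : S} (hz : z ≠ y) (n : ℕ) : discountedHit b mv y (n + 1) z
    = (∑ c, b z c * discountedHit b mv y n (mv z c)) / (2 * ∑ c, b z c) := by
  simp [discountedHit, hz]

lemma discountedHit_nonneg (hb : ∀ z c, 0 ≤ b z c) (n : ℕ) (z : S) :
    0 ≤ discountedHit b mv y n z := by
  induction n generalizing z with
  | zero => unfold discountedHit; split_ifs <;> simp
  | succ n ih =>
    by_cases hz : z = y
    · simp [hz, discountedHit_self]
    · rw [discountedHit_succ_of_ne hz]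
      exact div_nonneg (Finset.sum_nonneg fun c _ => mul_nonneg (hb _ _) (ih _))
        (mul_nonneg zero_le_two (Finset.sum_nonneg fun c _ => hb _ _))

lemma discountedHit_le_one (hb : ∀ z c, 0 ≤ b z c) (hpos : ∀ z, 0 < ∑ c, b z c) (n : ℕ) (z : S) :
    discountedHit b mv y n z ≤ 1 := by
  induction n generalizing z with
  | zero => unfold discountedHit; split_ifs <;> simp
  | succ n ih =>
    by_cases hz : z = y
    · simp [hz, discountedHit_self]
    · rw [discountedHit_succ_of_ne hz, div_le_one (mul_pos two_pos (hpos z))]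
      have : ∑ c, b z c * discountedHit b mv y n (mv z c) ≤ ∑ c, b z c :=
        Finset.sum_le_sum fun c _ => mul_le_of_le_one_right (hb _ _) (ih _)
      linarith [hpos z]

lemma discountedHit_le_succ (hb : ∀ z c, 0 ≤ b z c) (n : ℕ) (z : S) :
    discountedHit b mv y n z ≤ discountedHit b mv y (n + 1) z := by
  induction n generalizing z with
  | zero =>
    by_cases hz : z = y
    · simp [hz, discountedHit_self]
    · exact le_of_eq_of_le (by simp [discountedHit, hz]) (discountedHit_nonneg hb 1 z)
  | succ n ih =>
    by_cases hz : z = y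
    · simp [hz, discountedHit_self]
    · rw [discountedHit_succ_of_ne hz, discountedHit_succ_of_ne hz]
      have h2 : 0 ≤ 2 * ∑ c, b z c :=
        mul_nonneg zero_le_two (Finset.sum_nonneg fun c _ => hb _ _)
      gcongr with c
      · exact hb _ _
      · exact ih _

/-- Off the target the discounted hitting weight grows under the dynamics, at a rate that is at
least its own value. -/
lemma mul_discountedHit_le_sum (hb : ∀ z c, 0 ≤ b z c) (hpos : ∀ z, 0 < ∑ c, b z c) (n : ℕ) {z : S}
    (hz : z ≠ y) : (∑ c, b z c) * discountedHit b mv y n z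
      ≤ ∑ c, b z c * (discountedHit b mv y n (mv z c) - discountedHit b mv y n z) := by
  have h1 := discountedHit_le_succ (y := y) (mv := mv) hb n z
  rw [discountedHit_succ_of_ne hz, le_div_iff₀ (mul_pos two_pos (hpos z))] at h1
  simp only [mul_sub, Finset.sum_sub_distrib, ← Finset.sum_mul]
  linarith

lemma eventually_discountedHit_pos (hb : ∀ z c, 0 ≤ b z c) (hpos : ∀ z, 0 < ∑ c, b z c) {z : S}
    (hz : Relation.ReflTransGen (fun z z' => ∃ c, 0 < b z c ∧ mv z c = z') z y) :
    ∀ᶠ n in atTop, 0 < discountedHit b mv y n z := by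
  induction hz using Relation.ReflTransGen.head_induction_on with
  | refl => exact Eventually.of_forall fun n => by simp [discountedHit_self]
  | @head z z' h _ ih =>
    obtain ⟨c, hc, rfl⟩ := h
    by_cases hzy : z = y
    · exact Eventually.of_forall fun n => by simp [hzy, discountedHit_self]
    · obtain ⟨N, hN⟩ := eventually_atTop.1 ih
      refine eventually_atTop.2 ⟨N + 1, fun n hn => ?_⟩
      obtain ⟨m, rfl⟩ : ∃ m, n = m + 1 := ⟨n - 1, by omega⟩
      rw [discountedHit_succ_of_ne hzy]
      refine div_pos (Finset.sum_pos' (fun c _ => mul_nonneg (hb _ _) (discountedHit_nonneg hb _ _))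
        ⟨c, Finset.mem_univ _, mul_pos hc (hN m (by omega))⟩) (mul_pos two_pos (hpos z))

/-- A Lyapunov function `V` with negative drift off a finite set yields one whose drift is negative
off a single state `y` that can be reached from everywhere: subtract a large multiple of the
discounted hitting weight of `y`, which is positive on the finite set and grows under the
dynamics. -/
theorem exists_lyapunov_off_singleton (hb : ∀ z c, 0 ≤ b z c) (hpos : ∀ z, 0 < ∑ c, b z c) {B : ℝ}
    (hB : ∀ z, ∑ c, b z c ≤ B)
    (hreach : ∀ z, Relation.ReflTransGen (fun z z' => ∃ c, 0 < b z c ∧ mv z c = z') z y)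
    {V : S → ℝ} (hV : ∀ z, 0 ≤ V z) {F : Set S} (hF : F.Finite) {K : ℝ}
    (hK : ∀ z, ∑ c, b z c * (V (mv z c) - V z) ≤ K)
    (hdrift : ∀ z, z ∉ F → ∑ c, b z c * (V (mv z c) - V z) ≤ -1) {D : ℝ} (hD : 0 ≤ D) :
    ∃ W : S → ℝ, (∀ z, 0 ≤ W z) ∧
      ∀ z, z ≠ y → ∑ c, b z c * (W (mv z c) - W z) ≤ -(D * ∑ c, b z c) := by
  obtain ⟨n, hn⟩ : ∃ n, ∀ z ∈ F, 0 < discountedHit b mv y n z :=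
    (hF.eventually_all.2 fun z _ => eventually_discountedHit_pos hb hpos (hreach z)).exists
  set s := discountedHit b mv y n with hs
  set a := D * B with ha
  have hB0 : 0 ≤ B := (hpos y).le.trans (hB y)
  have ha0 : 0 ≤ a := mul_nonneg hD hB0
  obtain ⟨r, hr, hr0⟩ : ∃ r, (∀ z ∈ F, a * K + a ≤ r * ((∑ c, b z c) * s z)) ∧ 0 ≤ r := by
    refine ((hF.eventually_all.2 fun z hz => ?_).and (eventually_ge_atTop 0)).exists
    exact (tendsto_id.atTop_mul_const (mul_pos (hpos z) (hn z hz))).eventually_ge_atTop _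
  refine ⟨fun z => a * V z + r * (1 - s z), fun z => ?_, fun z hz => ?_⟩
  · have := discountedHit_le_one (mv := mv) (y := y) hb hpos n z
    exact add_nonneg (mul_nonneg ha0 (hV z)) (mul_nonneg hr0 (sub_nonneg.2 this))
  · have hsplit : ∑ c, b z c * (a * V (mv z c) + r * (1 - s (mv z c)) - (a * V z + r * (1 - s z)))
        = a * ∑ c, b z c * (V (mv z c) - V z) - r * ∑ c, b z c * (s (mv z c) - s z) := by
      rw [Finset.mul_sum, Finset.mul_sum, ← Finset.sum_sub_distrib]
      exact Finset.sum_congr rfl fun c _ => by ring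
    have h1 : r * ((∑ c, b z c) * s z) ≤ r * ∑ c, b z c * (s (mv z c) - s z) :=
      mul_le_mul_of_nonneg_left (mul_discountedHit_le_sum hb hpos n hz) hr0
    have h2 : D * ∑ c, b z c ≤ a := mul_le_mul_of_nonneg_left (hB z) hD
    rw [hsplit]
    by_cases hzF : z ∈ F
    · have h3 := mul_le_mul_of_nonneg_left (hK z) ha0
      have h4 := hr z hzF
      linarith
    · have h3 := mul_le_mul_of_nonneg_left (hdrift z hzF) ha0
      have h4 : 0 ≤ r * ((∑ c, b z c) * s z) :=
        mul_nonneg hr0 (mul_nonneg (hpos z).le (discountedHit_nonneg hb n z))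
      linarith

end Foster

/-! ### The drift under a utility maximising policy -/

namespace ConditionH

variable {h : ℝ → EReal}

lemma ne_top (hh : ConditionH h) {a : ℝ} (ha : 0 ≤ a) : h a ≠ ⊤ := by
  rcases ha.eq_or_lt with rfl | ha
  · exact ((hh.strictMono Set.self_mem_Ici (Set.mem_Ici.2 zero_le_one) zero_lt_one).trans_le
      le_top).ne
  · exact (hh.real_valued a ha).2

lemma differentiableAt (hh : ConditionH h) {a : ℝ} (ha : 0 < a) :
    DifferentiableAt ℝ (fun y => (h y).toReal) a :=
  hh.differentiable.differentiableAt (Ioi_mem_nhds ha)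

lemma toReal_le_tangent_of_pos (hh : ConditionH h) {a b : ℝ} (ha : 0 < a) (hb : 0 < b) :
    (h b).toReal ≤ (h a).toReal + deriv (fun y => (h y).toReal) a * (b - a) := by
  have hd := hh.differentiableAt ha
  rcases lt_trichotomy a b with hab | rfl | hab
  · have := hh.concave.slope_le_deriv (Set.mem_Ioi.2 ha) (Set.mem_Ioi.2 hb) hab hd
    rw [slope_def_field, div_le_iff₀ (sub_pos.2 hab)] at this
    linarith
  · simp
  · have := hh.concave.deriv_le_slope (Set.mem_Ioi.2 hb) (Set.mem_Ioi.2 ha) hab hd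
    rw [slope_def_field, le_div_iff₀ (sub_pos.2 hab)] at this
    linarith

/-- By concavity `h` lies below its tangents, at the endpoint `0` by continuity. -/
lemma toReal_le_tangent (hh : ConditionH h) {a b : ℝ} (ha : 0 < a) (hb : 0 ≤ b) (hbot : h b ≠ ⊥) :
    (h b).toReal ≤ (h a).toReal + deriv (fun y => (h y).toReal) a * (b - a) := by
  rcases hb.eq_or_lt with rfl | hb
  · have h1 : Tendsto (fun y => (h y).toReal) (𝓝[>] 0) (𝓝 (h 0).toReal) :=
      (EReal.tendsto_toReal (hh.ne_top le_rfl) hbot).comp hh.value_zero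
    have h2 : Tendsto (fun y => (h a).toReal + deriv (fun y => (h y).toReal) a * (y - a)) (𝓝[>] 0)
        (𝓝 ((h a).toReal + deriv (fun y => (h y).toReal) a * (0 - a))) :=
      (Continuous.tendsto (by fun_prop) 0).mono_left nhdsWithin_le_nhds
    refine le_of_tendsto_of_tendsto h1 h2 ?_
    filter_upwards [self_mem_nhdsWithin] with y hy
    exact hh.toReal_le_tangent_of_pos ha hy
  · exact hh.toReal_le_tangent_of_pos ha hb

lemma deriv_pos (hh : ConditionH h) {a : ℝ} (ha : 0 < a) :
    0 < deriv (fun y => (h y).toReal) a := by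
  have h1 := hh.toReal_le_tangent_of_pos ha (b := a + 1) (by linarith)
  have h2 := hh.strictMono (Set.mem_Ici.2 ha.le) (Set.mem_Ici.2 (by linarith : 0 ≤ a + 1))
    (by linarith)
  have h3 : (h a).toReal < (h (a + 1)).toReal := by
    rwa [← EReal.coe_lt_coe_iff, EReal.coe_toReal (hh.real_valued a ha).2 (hh.real_valued a ha).1,
      EReal.coe_toReal (hh.ne_top (by linarith)) (hh.real_valued (a + 1) (by linarith)).1]
  linarith

end ConditionH

section Drift

variable {ι : Type*} [Fintype ι] {C : Set (ι → ℝ)} {g : ℕ → ℝ} {h : ℝ → EReal}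
  {ψ : (ι → ℕ) → ι → ℝ} {ν : ι → ℝ}

lemma ConditionG.pos (hg : ConditionG g) {n : ℕ} (hn : 0 < n) : 0 < g n :=
  (hg.nonneg 0).trans_lt (hg.strictMono hn)

lemma coe_finsetSum_eReal {α : Type*} (s : Finset α) (f : α → ℝ) :
    ((∑ i ∈ s, f i : ℝ) : EReal) = ∑ i ∈ s, (f i : EReal) := by
  classical
  induction s using Finset.induction_on with
  | empty => simp
  | insert a s ha ih => rw [Finset.sum_insert ha, Finset.sum_insert ha, EReal.coe_add, ih]

lemma utility_eq_coe {z : ι → ℕ} {μ : ι → ℝ} (hμ : ∀ i, 0 < z i → h (μ i) ≠ ⊥ ∧ h (μ i) ≠ ⊤) :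
    utility g h z μ = ((∑ i with 0 < z i, g (z i) * (h (μ i)).toReal : ℝ) : EReal) := by
  rw [utility, coe_finsetSum_eReal]
  refine Finset.sum_congr rfl fun i hi => ?_
  obtain ⟨h1, h2⟩ := hμ i (Finset.mem_filter.1 hi).2
  rw [EReal.coe_mul, EReal.coe_toReal h2 h1]

/-- A nonempty queue with `h (μ i) = ⊥` makes the utility `⊥`, as its coefficient `g (z i)` is
positive. -/
lemma utility_eq_bot (hg : ConditionG g) {z : ι → ℕ} {μ : ι → ℝ} {i : ι} (hi : 0 < z i)
    (hμ : h (μ i) = ⊥) : utility g h z μ = ⊥ := by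
  classical
  rw [utility, ← Finset.add_sum_erase _ _ (Finset.mem_filter.2 ⟨Finset.mem_univ i, hi⟩), hμ,
    EReal.coe_mul_bot_of_pos (hg.pos hi), EReal.bot_add]

/-- The rates of a utility maximiser dominate those of any positive `ν` in the rate region in the
linear functional with weights `g (z i) * h' (ν i)`. This is where concavity of `h` replaces
convexity of the region. -/
lemma IsUtilityMaximising.sum_weighted_le (hψ : IsUtilityMaximising C g h ψ)
    (hC : IsRateRegion C) (hg : ConditionG g) (hh : ConditionH h) (hν : ν ∈ C)
    (hνpos : ∀ i, 0 < ν i) (z : ι → ℕ) :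
    ∑ i with 0 < z i, g (z i) * (deriv (fun y => (h y).toReal) (ν i) * (ν i - ψ z i)) ≤ 0 := by
  have hmax := hψ.isMax z ν hν
  have hψ0 : ∀ i, 0 ≤ ψ z i := hC.nonneg _ (hψ.mem z)
  rw [utility_eq_coe (fun i _ => hh.real_valued _ (hνpos i))] at hmax
  have hbot : ∀ i, 0 < z i → h (ψ z i) ≠ ⊥ := by
    intro i hi hbot
    rw [utility_eq_bot hg hi hbot] at hmax
    exact EReal.coe_ne_bot _ (le_bot_iff.1 hmax)
  rw [utility_eq_coe (fun i hi => ⟨hbot i hi, hh.ne_top (hψ0 i)⟩), EReal.coe_le_coe_iff] at hmax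
  calc _ ≤ ∑ i with 0 < z i, (g (z i) * (h (ν i)).toReal - g (z i) * (h (ψ z i)).toReal) := by
        refine Finset.sum_le_sum fun i hi => ?_
        have hi := (Finset.mem_filter.1 hi).2
        have := hh.toReal_le_tangent (hνpos i) (hψ0 i) (hbot i hi)
        rw [← mul_sub]
        exact mul_le_mul_of_nonneg_left (by linarith) (hg.nonneg _)
    _ ≤ 0 := by
        rw [Finset.sum_sub_distrib]
        linarith

/-- In a nonempty network some nonempty queue is served. -/
lemma IsUtilityMaximising.exists_pos (hψ : IsUtilityMaximising C g h ψ)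
    (hC : IsRateRegion C) (hg : ConditionG g) (hh : ConditionH h) (hν : ν ∈ C)
    (hνpos : ∀ i, 0 < ν i) {z : ι → ℕ} (hz : z ≠ 0) : ∃ i, 0 < z i ∧ 0 < ψ z i := by
  by_contra! hcon
  obtain ⟨j, hj⟩ := Function.ne_iff.1 hz
  have hj : 0 < z j := Nat.pos_of_ne_zero hj
  refine (hψ.sum_weighted_le hC hg hh hν hνpos z).not_gt
    (Finset.sum_pos (fun i hi => ?_) ⟨j, Finset.mem_filter.2 ⟨Finset.mem_univ j, hj⟩⟩)
  have hi := (Finset.mem_filter.1 hi).2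
  exact mul_pos (hg.pos hi) (mul_pos (hh.deriv_pos (hνpos i)) (by linarith [hcon i hi, hνpos i]))

/-- The weighted sum of the potentials `g 1 + ⋯ + g (z i)` of the queue lengths. -/
noncomputable def potential (g : ℕ → ℝ) (w : ι → ℝ) (z : ι → ℕ) : ℝ :=
  ∑ i, w i * ∑ k ∈ Finset.range (z i), g (k + 1)

lemma potential_nonneg (hg : ConditionG g) {w : ι → ℝ} (hw : ∀ i, 0 ≤ w i) (z : ι → ℕ) :
    0 ≤ potential g w z :=
  Finset.sum_nonneg fun i _ => mul_nonneg (hw i) (Finset.sum_nonneg fun _ _ => hg.nonneg _)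

lemma potential_update_sub [DecidableEq ι] (w : ι → ℝ) (z : ι → ℕ) (i : ι) (m : ℕ) :
    potential g w (Function.update z i m) - potential g w z
      = w i * (∑ k ∈ Finset.range m, g (k + 1) - ∑ k ∈ Finset.range (z i), g (k + 1)) := by
  unfold potential
  rw [← Finset.sum_sub_distrib, Finset.sum_eq_single i]
  · simp [mul_sub]
  · intro j _ hj
    simp [hj]
  · simp

lemma sum_clockRate_mul_potential_sub [DecidableEq ι] (hψ : IsUtilityMaximising C g h ψ)
    (lam w : ι → ℝ) (z : ι → ℕ) :
    ∑ c, clockRate lam ψ z c * (potential g w (jump z c) - potential g w z)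
      = ∑ i, w i * (lam i * g (z i + 1) - ψ z i * g (z i)) := by
  rw [Fintype.sum_sum_type, ← Finset.sum_add_distrib]
  refine Finset.sum_congr rfl fun i _ => ?_
  simp only [clockRate, jump, Sum.elim_inl, Sum.elim_inr, potential_update_sub,
    Finset.sum_range_succ, add_sub_cancel_left]
  rcases Nat.eq_zero_or_pos (z i) with h0 | hpos
  · simp [hψ.empty z i h0]
    ring
  · obtain ⟨m, hm⟩ : ∃ m, z i = m + 1 := ⟨z i - 1, by omega⟩
    rw [hm, Nat.add_sub_cancel, Finset.sum_range_succ _ m]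
    ring

/-- An upper bound on the contribution to the drift of the potential of a queue of length `n` with
arrival rate `l` if it were served at rate `v`; the constant `v * g 0` accounts for empty queues,
which are not served. -/
def queueDrift (g : ℕ → ℝ) (w l v : ℝ) (n : ℕ) : ℝ :=
  w * (l * g (n + 1) - v * g n + v * g 0)

lemma tendsto_queueDrift (hg : ConditionG g) {w l v : ℝ} (hw : 0 < w) (hlv : l < v) :
    Tendsto (queueDrift g w l v) atTop atBot := by
  -- the increments of `g` are eventually at most `(v - l) / (2 * l)` times its values
  have h1 : ∀ᶠ n in atTop, l * g (n + 1) ≤ (l + v) / 2 * g n := by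
    filter_upwards [hg.ratio.eventually_ge_atTop (2 * l / (v - l))] with n hn
    have hpos : 0 < g (n + 1) - g n := sub_pos.2 (hg.strictMono n.lt_succ_self)
    rw [div_le_div_iff₀ (sub_pos.2 hlv) hpos] at hn
    linarith
  have h2 : Tendsto (fun n => w * (-((v - l) / 2 * g n) + v * g 0)) atTop atBot := by
    refine Tendsto.const_mul_atBot hw (tendsto_atBot_add_const_right _ _ ?_)
    exact tendsto_neg_atTop_atBot.comp (hg.unbounded.const_mul_atTop (by linarith))
  refine tendsto_atBot_mono' _ ?_ h2
  filter_upwards [h1] with n hn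
  unfold queueDrift
  exact mul_le_mul_of_nonneg_left (by linarith) hw.le

/-- The drift of the potential with weights `h' (ν i)` is at most the drift that the fixed service
rates `ν` would give. -/
lemma drift_potential_le [DecidableEq ι] (hψ : IsUtilityMaximising C g h ψ)
    (hC : IsRateRegion C) (hg : ConditionG g) (hh : ConditionH h) (hν : ν ∈ C)
    (hνpos : ∀ i, 0 < ν i) (lam : ι → ℝ) (z : ι → ℕ) :
    ∑ c, clockRate lam ψ z c *
        (potential g (fun i => deriv (fun y => (h y).toReal) (ν i)) (jump z c)
          - potential g (fun i => deriv (fun y => (h y).toReal) (ν i)) z)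
      ≤ ∑ i, queueDrift g (deriv (fun y => (h y).toReal) (ν i)) (lam i) (ν i) (z i) := by
  rw [sum_clockRate_mul_potential_sub hψ]
  have h1 := hψ.sum_weighted_le hC hg hh hν hνpos z
  rw [Finset.sum_filter] at h1
  rw [← sub_nonpos, ← Finset.sum_sub_distrib]
  refine le_trans (Finset.sum_le_sum fun i _ => ?_) h1
  have hw := hh.deriv_pos (hνpos i)
  unfold queueDrift
  split_ifs with hi
  · have : 0 ≤ deriv (fun y => (h y).toReal) (ν i) * (ν i * g 0) :=
      mul_nonneg hw.le (mul_nonneg (hνpos i).le (hg.nonneg 0))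
    linarith
  · have h0 : z i = 0 := by omega
    rw [hψ.empty z i h0, h0]
    linarith

omit [Fintype ι] in
lemma exists_forall_le_of_tendsto_atBot {f : ℕ → ℝ} (hf : Tendsto f atTop atBot) :
    ∃ K, ∀ n, f n ≤ K := by
  obtain ⟨K, hK⟩ := bddAbove_range_of_tendsto_atTop_atBot hf
  exact ⟨K, fun n => hK ⟨n, rfl⟩⟩

/-- A sum of functions of the coordinates that tend to `-∞` is bounded above and is small off a
finite set. -/
lemma sum_comp_of_tendsto_atBot {f : ι → ℕ → ℝ} (hf : ∀ i, Tendsto (f i) atTop atBot) :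
    (∃ K, ∀ z : ι → ℕ, ∑ i, f i (z i) ≤ K) ∧ {z : ι → ℕ | -1 < ∑ i, f i (z i)}.Finite := by
  classical
  choose K hK using fun i => exists_forall_le_of_tendsto_atBot (hf i)
  refine ⟨⟨∑ i, K i, fun z => Finset.sum_le_sum fun i _ => hK i _⟩, ?_⟩
  have hfin : ∀ i, {n | -1 - ∑ j ∈ Finset.univ.erase i, K j < f i n}.Finite := by
    intro i
    have := (hf i).eventually_le_atBot (-1 - ∑ j ∈ Finset.univ.erase i, K j)
    rw [← Nat.cofinite_eq_atTop, eventually_cofinite] at this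
    simpa using this
  refine (Set.Finite.pi' hfin).subset fun z hz i => ?_
  have hz : -1 < ∑ i, f i (z i) := hz
  rw [← Finset.add_sum_erase _ _ (Finset.mem_univ i)] at hz
  have := Finset.sum_le_sum fun j (_ : j ∈ Finset.univ.erase i) => hK j (z j)
  change -1 - ∑ j ∈ Finset.univ.erase i, K j < f i (z i)
  linarith

/-- Every state can be reached from every other: serve the queues until all are empty, then let
customers arrive. -/
lemma IsUtilityMaximising.reaches [DecidableEq ι] (hψ : IsUtilityMaximising C g h ψ)
    (hC : IsRateRegion C) (hg : ConditionG g) (hh : ConditionH h) (hν : ν ∈ C)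
    (hνpos : ∀ i, 0 < ν i) {lam : ι → ℝ} (hlam : ∀ i, 0 < lam i) (z y : ι → ℕ) :
    Relation.ReflTransGen (fun z z' => ∃ c, 0 < clockRate lam ψ z c ∧ jump z c = z') z y := by
  have hup : ∀ n, ∀ z : ι → ℕ, z ≤ y → ∑ i, (y i - z i) = n →
      Relation.ReflTransGen (fun z z' => ∃ c, 0 < clockRate lam ψ z c ∧ jump z c = z') z y := by
    intro n
    induction n with
    | zero =>
      intro z hzy hn
      have : z = y := by
        funext i
        have h1 : y i - z i = 0 := (Finset.sum_eq_zero_iff.1 hn) i (Finset.mem_univ i)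
        have h2 : z i ≤ y i := hzy i
        omega
      rw [this]
    | succ n ih =>
      intro z hzy hn
      obtain ⟨i, hi⟩ : ∃ i, y i - z i ≠ 0 := by
        by_contra! hcon
        simp [hcon] at hn
      have hle : jump z (Sum.inl i) ≤ y := by
        intro j
        rcases eq_or_ne j i with rfl | hj
        · simp [jump]; omega
        · simpa [jump, hj] using hzy j
      refine Relation.ReflTransGen.head ⟨Sum.inl i, hlam i, rfl⟩ (ih _ hle ?_)
      rw [← Finset.add_sum_erase _ _ (Finset.mem_univ i)] at hn ⊢
      have : ∑ j ∈ Finset.univ.erase i, (y j - jump z (Sum.inl i) j)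
          = ∑ j ∈ Finset.univ.erase i, (y j - z j) :=
        Finset.sum_congr rfl fun j hj => by simp [jump, Finset.ne_of_mem_erase hj]
      rw [this]
      simp [jump]
      omega
  have hdown : ∀ n, ∀ z : ι → ℕ, ∑ i, z i = n →
      Relation.ReflTransGen (fun z z' => ∃ c, 0 < clockRate lam ψ z c ∧ jump z c = z') z 0 := by
    intro n
    induction n with
    | zero =>
      intro z hn
      have : z = 0 := funext fun i => (Finset.sum_eq_zero_iff.1 hn) i (Finset.mem_univ i)
      rw [this]
    | succ n ih =>
      intro z hn
      have hz : z ≠ 0 := by rintro rfl; simp at hn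
      obtain ⟨i, hi, hψi⟩ := hψ.exists_pos hC hg hh hν hνpos hz
      refine Relation.ReflTransGen.head ⟨Sum.inr i, hψi, rfl⟩ (ih _ ?_)
      rw [← Finset.add_sum_erase _ _ (Finset.mem_univ i)] at hn ⊢
      have : ∑ j ∈ Finset.univ.erase i, jump z (Sum.inr i) j = ∑ j ∈ Finset.univ.erase i, z j :=
        Finset.sum_congr rfl fun j hj => by simp [jump, Finset.ne_of_mem_erase hj]
      rw [this]
      simp [jump]
      omega
  exact (hdown _ z rfl).trans (hup _ 0 (fun i => Nat.zero_le _) rfl)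

end Drift

/-! ### Positive recurrence of the network -/

lemma IsRateRegion.exists_bound {ι : Type*} [Fintype ι] {C : Set (ι → ℝ)} (hC : IsRateRegion C) :
    ∃ M, ∀ μ ∈ C, ∀ i, μ i ≤ M := by
  obtain ⟨M, hM⟩ := hC.compact.isBounded.exists_norm_le
  exact ⟨M, fun μ hμ i => (le_abs_self _).trans ((norm_le_pi_norm μ i).trans (hM μ hμ))⟩

/-- A Lyapunov function with negative drift off the single state `y`. -/
lemma exists_network_lyapunov {ι : Type*} [Fintype ι] [Nonempty ι] [DecidableEq ι]
    {C : Set (ι → ℝ)} (hC : IsRateRegion C) {g : ℕ → ℝ} (hg : ConditionG g) {h : ℝ → EReal}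
    (hh : ConditionH h) {ψ : (ι → ℕ) → ι → ℝ} (hψ : IsUtilityMaximising C g h ψ) {lam : ι → ℝ}
    (hlam : ∀ i, 0 < lam i) {ν : ι → ℝ} (hν : ν ∈ C) (hlamν : ∀ i, lam i < ν i) (y : ι → ℕ)
    {D : ℝ} (hD : 0 ≤ D) :
    ∃ W : (ι → ℕ) → ℝ, (∀ z, 0 ≤ W z) ∧ ∀ z, z ≠ y →
      ∑ c, clockRate lam ψ z c * (W (jump z c) - W z) ≤ -(D * ∑ c, clockRate lam ψ z c) := by
  have hνpos : ∀ i, 0 < ν i := fun i => (hlam i).trans (hlamν i)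
  have hψ0 : ∀ z i, 0 ≤ ψ z i := fun z => hC.nonneg _ (hψ.mem z)
  obtain ⟨M, hM⟩ := hC.exists_bound
  have hB : ∀ z, ∑ c, clockRate lam ψ z c ≤ ∑ i, lam i + ∑ _i : ι, M := fun z => by
    rw [Fintype.sum_sum_type]
    exact add_le_add le_rfl (Finset.sum_le_sum fun i _ => hM _ (hψ.mem z) i)
  have hw := fun i => hh.deriv_pos (hνpos i)
  obtain ⟨⟨K, hK⟩, hfin⟩ := sum_comp_of_tendsto_atBot fun i =>
    tendsto_queueDrift hg (hw i) (hlamν i)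
  have hle := drift_potential_le hψ hC hg hh hν hνpos lam
  exact exists_lyapunov_off_singleton (clockRate_nonneg hlam hψ0) (sum_clockRate_pos hlam hψ0) hB
    (fun z => hψ.reaches hC hg hh hν hνpos hlam z y) (potential_nonneg hg fun i => (hw i).le) hfin
    (fun z => (hle z).trans (hK z)) (fun z hz => (hle z).trans (not_lt.1 hz)) hD

/-- The gaps of the driving Poisson processes have the law `clockLaw`, and almost surely the queue
lengths are a path driven by them. -/
lemma IsNetworkProcess.exists_gaps {ι : Type*} [Fintype ι] {lam : ι → ℝ} (hlam : ∀ i, 0 ≤ lam i)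
    {ψ : (ι → ℕ) → ι → ℝ} (hψ : ∀ z i, 0 ≤ ψ z i) {x : ι → ℕ} {Ω : Type*} [MeasurableSpace Ω]
    {P : Measure Ω} {X : ℝ → Ω → ι → ℕ} (hX : IsNetworkProcess lam ψ x P X) :
    ∃ e : Ω → (ι ⊕ ι) × ℕ → ℝ, HasLaw e (clockLaw (ι ⊕ ι)) P ∧
      ∀ᵐ ω ∂P, IsPath lam ψ x (e ω) fun t => X t ω := by
  obtain ⟨N, ⟨gap, hlaw, hindep, hN⟩, hdyn⟩ := hX.dynamics
  refine ⟨fun ω p => gap p.1 p.2 ω, iIndepFun.hasLaw_infinitePi (fun p => hlaw p.1 p.2) hindep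
    (aemeasurable_pi_iff.2 fun p => (hlaw p.1 p.2).aemeasurable), ?_⟩
  filter_upwards [hX.rightCont, ae_all_iff.2 hN, hdyn] with ω h1 h2 h3
  refine ⟨h1, fun t ht i => ?_⟩
  have h4 : elapsed lam ψ (fun t => X t ω) (.inl i) t = lam i * t := by
    simp [elapsed, clockRate, mul_comm]
  have h5 := h3 t ht i
  rw [h2 _ _ (mul_nonneg (hlam i) ht),
    h2 _ _ (intervalIntegral.integral_nonneg ht fun τ _ => hψ _ _)] at h5
  rw [h4]
  exact h5

end QueueNetwork

theorem mainTheorem3 {ι : Type*} [Fintype ι] [Nonempty ι]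
    (C : Set (ι → ℝ)) (hC : QueueNetwork.IsRateRegion C)
    (g : ℕ → ℝ) (hg : QueueNetwork.ConditionG g)
    (h : ℝ → EReal) (hh : QueueNetwork.ConditionH h)
    (ψ : (ι → ℕ) → ι → ℝ) (hψ : QueueNetwork.IsUtilityMaximising C g h ψ)
    (lam : ι → ℝ) (hlam : ∀ i, 0 < lam i)
    (hsub : ∃ ν ∈ C, ∀ i, lam i < ν i)
    {Ω : Type*} [MeasurableSpace Ω] (P : Measure Ω) [IsProbabilityMeasure P]
    (x : ι → ℕ) (X : ℝ → Ω → ι → ℕ)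
    (hX : QueueNetwork.IsNetworkProcess lam ψ x P X) (y : ι → ℕ) :
    ∫⁻ ω, QueueNetwork.returnTime (fun t => X t ω) y ∂P < ⊤ := by
  classical
  obtain ⟨ν, hν, hlamν⟩ := hsub
  have hψ0 : ∀ z i, 0 ≤ ψ z i := fun z => hC.nonneg _ (hψ.mem z)
  obtain ⟨M, hM⟩ := hC.exists_bound
  have hM' : ∀ z i, ψ z i ≤ M := fun z => hM _ (hψ.mem z)
  have i := Classical.arbitrary ι
  have hcost := QueueNetwork.lintegral_jumpCost_lt_top (hlam i)
  obtain ⟨W, hW, hdrift⟩ := QueueNetwork.exists_network_lyapunov hC hg hh hψ hlam hν hlamν y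
    (ENNReal.toReal_nonneg (a := ∫⁻ e, QueueNetwork.jumpCost lam i e ∂QueueNetwork.clockLaw _))
  have hfin := QueueNetwork.lintegral_iSup_returnCost_lt_top
    (QueueNetwork.clockRate_nonneg hlam hψ0) (QueueNetwork.sum_clockRate_pos hlam hψ0)
    (QueueNetwork.measurable_jumpCost lam i) ENNReal.toReal_nonneg
    (ENNReal.ofReal_toReal hcost.ne).ge hW hdrift x
  obtain ⟨e, he, hpath⟩ := hX.exists_gaps (fun i => (hlam i).le) hψ0
  have hle := ae_of_ae_map he.aemeasurable
    (he.map_eq ▸ QueueNetwork.ae_forall_isPath_returnTime_le hlam hψ0 hM' i y x)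
  refine lt_of_le_of_lt (lintegral_mono_ae ?_) (lt_of_eq_of_lt (lintegral_map' ?_
    he.aemeasurable).symm (he.map_eq ▸ hfin))
  · filter_upwards [hle, hpath] with ω h1 h2 using h1 _ h2
  · exact (Measurable.iSup fun n => QueueNetwork.measurable_returnCost
      (QueueNetwork.measurable_jumpCost lam i) n x).aemeasurable
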